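/- Let $n\ge 1$, let $\vec p=(p_1,\dots,p_n)$ with $1<p_i<\infty$ for every $i$, and let $t,r$ satisfy $$1<\frac{n}{\sum_{i=1}^n 1/p_i}<t<r<\infty\qquad\text{or}\qquad 1<\frac{n}{\sum_{i=1}^n 1/p_i}\le t<r=\infty .$$ For a measurable function $f$ on $\mathbb R^n$ put $$\|f\|_{L^{\vec p}}=\Big(\int_{\mathbb R}\cdots\Big(\int_{\mathbb R}|f(x_1,\dots,x_n)|^{p_1}\,dx_1\Big)^{p_2/p_1}\cdots dx_n\Big)^{1/p_n},$$ $$\|f\|_{M_{\vec p}^{t,r}}=\Big(\sum_{Q\in\mathcal D}|Q|^{\frac rt-\frac rn\sum_{i=1}^n\frac1{p_i}}\,\|f\chi_Q\|_{L^{\vec p}}^r\Big)^{1/r}$$ (a supremum over $Q$ if $r=\infty$), where $\mathcal D$ is the family of dyadic cubes $\prod_{i=1}^n[2^{-j}m_i,2^{-j}(m_i+1))$, $j\in\mathbb Z$, $m\in\mathbb Z^n$. For a sequence of measurable functions $f_k:\mathbb R^n\to\mathbb C$ and $1<u\le\infty$ put $\|\{f_k\}\|_{M_{\vec p}^{t,r}(\ell^u)}=\big\|\big(\sum_{k=1}^\infty|f_k|^u\big)^{1/u}\big\|_{M_{\vec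 p}^{t,r}}$ (with $\sup_k|f_k|$ if $u=\infty$), and let $M_{\vec p}^{t,r}(\ell^u)$ be the set of those sequences for which this is finite. Let $\mathcal Mf(x)=\sup_{B\ni x}\frac1{|B|}\int_B|f(y)|\,dy$, the supremum being over all open balls $B$ containing $x$. (a) For every $1<u\le\infty$ there is a constant $C<\infty$, depending only on $n,\vec p,t,r,u$, such that for all $\{f_k\}_{k\in\mathbb N}\in M_{\vec p}^{t,r}(\ell^u)$ $$\|\{\mathcal Mf_k\}_{k\in\mathbb N}\|_{M_{\vec p}^{t,r}(\ell^u)}\le C\,\|\{f_k\}_{k\in\mathbb N}\|_{M_{\vec p}^{t,r}(\ell^u)} .$$ (b) For all $1<u_1,u_2<\infty$ there is a constant $C<\infty$, depending only on $n,\vec p,t,r,u_1,u_2$, such that for all measurable $f_{k_1,k_2}:\mathbb R^n\to\mathbb C$, $k_1,k_2\in\mathbb N$, $$\Big\|\Big(\sum_{k_2=1}^\infty\Big(\sum_{k_1=1}^\infty|\mathcal Mf_{k_1,k_2}|^{u_1}\Big)^{u_2/u_1}\Big)^{1/u_2}\Big\|_{M_{\vec p}^{t,r}}\le C\,\Big\|\Big(\sum_{k_2=1}^\infty\Big(\sum_{k_1=1}^\infty|f_{k_1,k_2}|^{u_1}\Big)^{u_2/u_1}\Big)^{1/u_2}\Big\|_{M_{\vec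 p}^{t,r}} .$$ -/

import Mathlib

open MeasureTheory
open scoped ENNReal NNReal

noncomputable section

/-- The `ℓ^u` norm, `0 < u ≤ ∞`, of a family of numbers in `[0, ∞]`. -/
def ellNorm {ι : Type*} (u : ℝ≥0∞) (a : ι → ℝ≥0∞) : ℝ≥0∞ :=
  if u = ∞ then ⨆ i, a i else (∑' i, a i ^ u.toReal) ^ (1 / u.toReal)

/-- The iterated norm `‖ ⋯ ‖ ‖g(x₁, …, xₙ)‖_{L^{p₁}(dx₁)} ‖_{L^{p₂}(dx₂)} ⋯ ‖_{L^{pₙ}(dxₙ)}`: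
the first variable is integrated first. -/
def iteratedLpNorm : (n : ℕ) → (Fin n → ℝ≥0∞) → ((Fin n → ℝ) → ℝ≥0∞) → ℝ≥0∞
  | 0, _, g => g Fin.elim0
  | n + 1, p, g =>
      iteratedLpNorm n (Fin.tail p)
        (fun y => eLpNorm (fun s : ℝ => g (Fin.cons s y)) (p 0) volume)

/-- The mixed Lebesgue norm `‖f‖_{L^{p⃗}}` on `ℝⁿ`, for functions with values in `ℂ` or
in `[0, ∞]`. -/
def mixedLpNorm {n : ℕ} {ε : Type*} [ENorm ε] (p : Fin n → ℝ≥0∞)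
    (f : EuclideanSpace ℝ (Fin n) → ε) : ℝ≥0∞ :=
  iteratedLpNorm n p (fun x => ‖f (WithLp.toLp 2 x)‖ₑ)

/-- The dyadic cube `Q_{j,m} = ∏ᵢ [2^{-j} mᵢ, 2^{-j} (mᵢ + 1))`. -/
def dyadicCube {n : ℕ} (j : ℤ) (m : Fin n → ℤ) : Set (EuclideanSpace ℝ (Fin n)) :=
  {x | ∀ i, (2 : ℝ) ^ (-j) * (m i : ℝ) ≤ x i ∧ x i < (2 : ℝ) ^ (-j) * ((m i : ℝ) + 1)}

/-- The mixed Bourgain–Morrey norm: the `ℓ^r` norm over all dyadic cubes `Q` of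
`|Q|^{1/t - (1/n) ∑ᵢ 1/pᵢ} ‖f χ_Q‖_{L^{p⃗}}`. -/
def mixedBMNorm {n : ℕ} {ε : Type*} [ENorm ε] (p : Fin n → ℝ≥0∞) (t r : ℝ≥0∞)
    (f : EuclideanSpace ℝ (Fin n) → ε) : ℝ≥0∞ :=
  ellNorm r (fun Q : ℤ × (Fin n → ℤ) =>
    volume (dyadicCube Q.1 Q.2) ^ ((t⁻¹).toReal - (1 / (n : ℝ)) * ∑ i, ((p i)⁻¹).toReal) *
      mixedLpNorm p ((dyadicCube Q.1 Q.2).indicator (fun x => ‖f x‖ₑ)))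

/-- The mixed vector-valued Bourgain–Morrey norm `‖{f_k}‖_{M_{p⃗}^{t,r}(ℓ^u)}`. -/
def mixedBMSeqNorm {n : ℕ} {ε : Type*} [ENorm ε] (p : Fin n → ℝ≥0∞) (t r u : ℝ≥0∞)
    (f : ℕ → EuclideanSpace ℝ (Fin n) → ε) : ℝ≥0∞ :=
  mixedBMNorm p t r (fun x => ellNorm u (fun k => ‖f k x‖ₑ))

/-- Membership of a sequence in the mixed vector-valued Bourgain–Morrey space. -/
def MemMixedBMSeq {n : ℕ} (p : Fin n → ℝ≥0∞) (t r u : ℝ≥0∞)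
    (f : ℕ → EuclideanSpace ℝ (Fin n) → ℂ) : Prop :=
  (∀ k, AEMeasurable (f k) volume) ∧ mixedBMSeqNorm p t r u f < ∞

/-- The (uncentred) Hardy–Littlewood maximal function: the supremum of the averages of `|f|`
over all open Euclidean balls containing `x`. -/
def hlMaximal {n : ℕ} (f : EuclideanSpace ℝ (Fin n) → ℂ) (x : EuclideanSpace ℝ (Fin n)) :
    ℝ≥0∞ :=
  ⨆ (c : EuclideanSpace ℝ (Fin n)) (R : ℝ) (_ : x ∈ Metric.ball c R),
    (volume (Metric.ball c R))⁻¹ * ∫⁻ y in Metric.ball c R, ‖f y‖ₑ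

end

noncomputable section

/-! The proof combines a local estimate in the mixed Lebesgue norm, for functions with values in a
lattice, with a summation over dyadic cubes.

Summation. Let x lie in a dyadic cube Q, and let Q_l be the l-th ancestor of Q. A ball containing x
is either so small that it lies in 3Q, or it lies in some 3Q_l, l ≥ 1, of comparable size. So on Q
the maximal function of g is at most a constant times the strong maximal function of g·1_{3Q} plus
the sum over l ≥ 1 of the averages of g over 3Q_l (`hlFn_le_tsum_pieceFn`). With σ = ∑ 1/p_i,
passing from the norm of 1_{Q_l} to that of 1_Q gains 2^{-lσ} (`exists_iteratedLpNorm_pieceFn_le`);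
together with the weights |Q|^{1/t-σ/n} this becomes 2^{-ln/t}. A cube is the l-th ancestor of
2^{ln} cubes, so the ℓ^r norm loses 2^{ln/r}. As t < r, the resulting geometric series converges
(`exists_mixedBMNorm_hlFn_le`).

Local estimate. The strong maximal function is a composition of one-dimensional maximal operators,
and the mixed norm is treated one variable at a time (`exists_iteratedLpNorm_strongMax_le`). The
induction runs over all lattice norms N at once, since the L^{p_1} norm of N is again such a norm.
What is needed is that boundedness of the maximal operator passes from N to L^q(N)
(`IsMaxNorm.powNorm`). In L^q this is Tonelli's theorem; the other exponents follow by Rubio de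
Francia extrapolation (`exists_isDominated_of_exponent`), which requires inequalities with A_p
weights, so `IsMaxNorm` carries weighted inequalities throughout. The scalar case is Muckenhoupt's
theorem (`IsAp.lintegral_maxFn_rpow_le`).

For finite exponents ℓ^u and ℓ^{u₂}(ℓ^{u₁}) arise from this construction with counting measure. For
u = ∞ the supremum is moved inside the maximal operator and the scalar case applies. -/

/-- The `L^q(ν)` norm of a `[0, ∞]`-valued function, for a real exponent `q`. -/
def powNorm {α : Type*} [MeasurableSpace α] (ν : Measure α) (q : ℝ) (f : α → ℝ≥0∞) : ℝ≥0∞ :=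
  (∫⁻ x, f x ^ q ∂ν) ^ (1 / q)

/-! ### Minkowski's inequality for finite and countable sums in L^q. -/

section PowNorm

variable {α : Type*} [MeasurableSpace α] {ν : Measure α} {q : ℝ}

theorem powNorm_mono (hq : 0 ≤ q) {f g : α → ℝ≥0∞} (h : ∀ x, f x ≤ g x) :
    powNorm ν q f ≤ powNorm ν q g :=
  ENNReal.rpow_le_rpow (lintegral_mono fun x => ENNReal.rpow_le_rpow (h x) hq)
    (by positivity)

theorem powNorm_rpow (hq : 0 < q) (f : α → ℝ≥0∞) :
    powNorm ν q f ^ q = ∫⁻ x, f x ^ q ∂ν := by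
  rw [powNorm, ← ENNReal.rpow_mul, one_div_mul_cancel hq.ne', ENNReal.rpow_one]

theorem powNorm_le_iff (hq : 0 < q) {f : α → ℝ≥0∞} {c : ℝ≥0∞} :
    powNorm ν q f ≤ c ↔ ∫⁻ x, f x ^ q ∂ν ≤ c ^ q := by
  rw [powNorm, one_div, ENNReal.rpow_inv_le_iff hq]

theorem powNorm_const_mul (hq : 0 < q) {c : ℝ≥0∞} (hc : c ≠ ∞) (f : α → ℝ≥0∞) :
    powNorm ν q (fun x => c * f x) = c * powNorm ν q f := by
  simp_rw [powNorm, ENNReal.mul_rpow_of_nonneg _ _ hq.le]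
  rw [lintegral_const_mul' _ _ (ENNReal.rpow_ne_top_of_nonneg hq.le hc),
    ENNReal.mul_rpow_of_nonneg _ _ (by positivity), ← ENNReal.rpow_mul,
    mul_one_div_cancel hq.ne', ENNReal.rpow_one]

theorem powNorm_add_le (hq : 1 ≤ q) {f g : α → ℝ≥0∞} (hf : Measurable f) (hg : Measurable g) :
    powNorm ν q (fun x => f x + g x) ≤ powNorm ν q f + powNorm ν q g :=
  ENNReal.lintegral_Lp_add_le hf.aemeasurable hg.aemeasurable hq

theorem powNorm_sum_le (hq : 1 ≤ q) {f : ℕ → α → ℝ≥0∞} (hf : ∀ l, Measurable (f l)) (n : ℕ) :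
    powNorm ν q (fun x => ∑ l ∈ Finset.range n, f l x)
      ≤ ∑ l ∈ Finset.range n, powNorm ν q (f l) := by
  have hq0 : 0 < q := by linarith
  induction n with
  | zero => simp [powNorm, ENNReal.zero_rpow_of_pos hq0, hq0]
  | succ n ih =>
    simp_rw [Finset.sum_range_succ]
    exact (powNorm_add_le hq (Finset.measurable_fun_sum _ fun l _ => hf l) (hf n)).trans
      (add_le_add_left ih _)

theorem ENNReal.iSup_rpow_of_pos {ι : Sort*} (hq : 0 < q) (a : ι → ℝ≥0∞) :
    (⨆ i, a i) ^ q = ⨆ i, a i ^ q :=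
  (ENNReal.orderIsoRpow q hq).map_iSup a

theorem powNorm_tsum_le (hq : 1 ≤ q) {f : ℕ → α → ℝ≥0∞} (hf : ∀ l, Measurable (f l)) :
    powNorm ν q (fun x => ∑' l, f l x) ≤ ∑' l, powNorm ν q (f l) := by
  have hq0 : 0 < q := by linarith
  rw [powNorm_le_iff hq0]
  simp_rw [ENNReal.tsum_eq_iSup_nat (f := fun l => f l _), ENNReal.iSup_rpow_of_pos hq0]
  rw [lintegral_iSup]
  · refine iSup_le fun n => ?_
    rw [← powNorm_le_iff hq0]
    exact (powNorm_sum_le hq hf n).trans (ENNReal.sum_le_tsum _)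
  · exact fun n => (Finset.measurable_fun_sum _ fun l _ => hf l).pow_const _
  · intro m n hmn x
    exact ENNReal.rpow_le_rpow
      (Finset.sum_le_sum_of_subset (Finset.range_mono hmn)) hq0.le

end PowNorm

/-! ### The layer cake formula for a single number. -/

section LayerCake

theorem lintegral_layer_of_ne_top {q : ℝ} (hq : 0 < q) {a : ℝ≥0∞} (ha : a ≠ ∞) :
    ∫⁻ l in Set.Ioi (0 : ℝ), (if ENNReal.ofReal l < a then ENNReal.ofReal (q * l ^ (q - 1)) else 0)
      = a ^ q := by
  lift a to ℝ≥0 using ha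
  have h1 : ∫⁻ l in Set.Ioi (0 : ℝ),
      (if ENNReal.ofReal l < a then ENNReal.ofReal (q * l ^ (q - 1)) else 0)
      = ∫⁻ l in Set.Ioo (0 : ℝ) a, ENNReal.ofReal (q * l ^ (q - 1)) := by
    rw [← lintegral_indicator measurableSet_Ioi, ← lintegral_indicator measurableSet_Ioo]
    congr 1
    ext l
    by_cases hl : 0 < l
    · by_cases hla : l < a
      · have : ENNReal.ofReal l < a := by
          rw [ENNReal.ofReal_lt_iff_lt_toReal hl.le (by simp)]; simpa using hla
        simp [Set.indicator, hl, hla, this]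
      · have : ¬ ENNReal.ofReal l < a := by
          rw [ENNReal.ofReal_lt_iff_lt_toReal hl.le (by simp)]; simpa using hla
        simp only [Set.indicator, Set.mem_Ioi, hl, this, Set.mem_Ioo, hla]; simp
    · simp [Set.indicator, hl]
  have hint : IntegrableOn (fun l : ℝ => q * l ^ (q - 1)) (Set.Ioc 0 (a : ℝ)) :=
    ((intervalIntegrable_iff_integrableOn_Ioc_of_le a.2).1
      (intervalIntegral.intervalIntegrable_rpow' (by linarith))).const_mul q
  rw [h1, restrict_Ioo_eq_restrict_Ioc, ← ofReal_integral_eq_lintegral_ofReal hint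
    ((ae_restrict_mem measurableSet_Ioc).mono fun l hl => by
      have := hl.1; simp only [Pi.zero_apply]; positivity),
    ← intervalIntegral.integral_of_le (NNReal.coe_nonneg a), intervalIntegral.integral_const_mul,
    integral_rpow (Or.inl (by linarith))]
  rw [sub_add_cancel, Real.zero_rpow hq.ne', sub_zero, mul_div_cancel₀ _ hq.ne',
    ← ENNReal.ofReal_rpow_of_nonneg (NNReal.coe_nonneg a) hq.le, ENNReal.ofReal_coe_nnreal]

theorem lintegral_layer {q : ℝ} (hq : 0 < q) (a : ℝ≥0∞) :
    ∫⁻ l in Set.Ioi (0 : ℝ), (if ENNReal.ofReal l < a then ENNReal.ofReal (q * l ^ (q - 1)) else 0)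
      = a ^ q := by
  by_cases ha : a = ∞
  · subst ha
    rw [ENNReal.top_rpow_of_pos hq, eq_top_iff]
    -- The integral for the value ∞ dominates the one for the finite value `b ^ (1 / q)`, which is
    -- `b`; here `b` is arbitrary.
    refine ENNReal.le_of_forall_nnreal_lt fun b _ => ?_
    have hb : (b : ℝ≥0∞) = ((b : ℝ≥0∞) ^ (1 / q)) ^ q := by
      rw [← ENNReal.rpow_mul, one_div_mul_cancel hq.ne', ENNReal.rpow_one]
    rw [hb, ← lintegral_layer_of_ne_top hq
      (ENNReal.rpow_ne_top_of_nonneg (by positivity) ENNReal.coe_ne_top)]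
    refine lintegral_mono fun l => ?_
    dsimp only
    split_ifs with h1 h2
    · exact le_rfl
    · exact absurd ENNReal.ofReal_lt_top h2
    · exact zero_le
    · exact le_rfl
  · exact lintegral_layer_of_ne_top hq ha

end LayerCake

/-! ### The one-dimensional maximal operator with respect to an arbitrary measure. -/

section Maximal

/-- The closed interval whose end points are the two given rationals. -/
def ratIcc (i : ℚ × ℚ) : Set ℝ := Set.Icc (i.1 : ℝ) i.2

theorem measurableSet_ratIcc (i : ℚ × ℚ) : MeasurableSet (ratIcc i) := measurableSet_Icc

/-- Take a subfamily of least cardinality with the same union. If three of its intervals contained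
x, then one with the leftmost left end and one with the rightmost right end would together cover any
third, which could be dropped. -/
theorem exists_subcover_overlap_le_two (s : Finset (ℚ × ℚ)) :
    ∃ t ⊆ s, (⋃ i ∈ s, ratIcc i) = (⋃ i ∈ t, ratIcc i) ∧
      ∀ x : ℝ, ∑ i ∈ t, (ratIcc i).indicator (fun _ => (1 : ℝ≥0∞)) x ≤ 2 := by
  classical
  obtain ⟨t, ht, hmin⟩ := Finset.exists_min_image
    (s.powerset.filter fun t => (⋃ i ∈ s, ratIcc i) = (⋃ i ∈ t, ratIcc i)) Finset.card
    ⟨s, by simp⟩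
  simp only [Finset.mem_filter, Finset.mem_powerset] at ht hmin
  refine ⟨t, ht.1, ht.2, fun x => ?_⟩
  have key : (t.filter fun i => x ∈ ratIcc i).card ≤ 2 := by
    by_contra! hcard
    set T := t.filter fun i => x ∈ ratIcc i with hT
    have hne : T.Nonempty := Finset.card_pos.1 (by omega)
    obtain ⟨a, haT, ha⟩ := Finset.exists_min_image T (fun i => i.1) hne
    obtain ⟨b, hbT, hb⟩ := Finset.exists_max_image T (fun i => i.2) hne
    obtain ⟨c, hcT, hc⟩ : ∃ c ∈ T, c ∉ ({a, b} : Finset (ℚ × ℚ)) := by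
      by_contra! h
      have := Finset.card_le_card (show T ⊆ {a, b} from h)
      have := Finset.card_le_two (a := a) (b := b)
      omega
    simp only [Finset.mem_insert, Finset.mem_singleton, not_or] at hc
    simp only [hT, Finset.mem_filter] at haT hbT hcT ha hb
    have hsub : ratIcc c ⊆ ratIcc a ∪ ratIcc b := by
      intro y hy
      have h1 : (a.1 : ℝ) ≤ c.1 := by exact_mod_cast ha c hcT
      have h2 : (c.2 : ℝ) ≤ b.2 := by exact_mod_cast hb c hcT
      have h3 := haT.2
      have h4 := hbT.2
      simp only [ratIcc, Set.mem_Icc, Set.mem_union] at *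
      rcases le_total y x with h | h
      · left; constructor <;> linarith
      · right; constructor <;> linarith
    have := hmin (t.erase c) ⟨(Finset.erase_subset _ _).trans ht.1, by
      rw [ht.2]
      refine le_antisymm (Set.iUnion₂_subset fun i hi => ?_)
        (Set.biUnion_subset_biUnion_left fun i hi => Finset.mem_of_mem_erase hi)
      by_cases hic : i = c
      · subst hic
        refine hsub.trans (Set.union_subset ?_ ?_)
        · exact Set.subset_biUnion_of_mem (u := ratIcc)
            (Finset.mem_erase.2 ⟨Ne.symm hc.1, haT.1⟩ : a ∈ t.erase i)
        · exact Set.subset_biUnion_of_mem (u := ratIcc)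
            (Finset.mem_erase.2 ⟨Ne.symm hc.2, hbT.1⟩ : b ∈ t.erase i)
      · exact Set.subset_biUnion_of_mem (u := ratIcc)
            (Finset.mem_erase.2 ⟨hic, hi⟩ : i ∈ t.erase c)⟩
    have := Finset.card_erase_lt_of_mem hcT.1
    omega
  calc ∑ i ∈ t, (ratIcc i).indicator (fun _ => (1 : ℝ≥0∞)) x
      = ((t.filter fun i => x ∈ ratIcc i).card : ℝ≥0∞) := by
        simp [Set.indicator]
    _ ≤ 2 := by exact_mod_cast key

/-- The average of `f` over a rational interval with respect to `ν`. -/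
def ratAvg (ν : Measure ℝ) (i : ℚ × ℚ) (f : ℝ → ℝ≥0∞) : ℝ≥0∞ :=
  (ν (ratIcc i))⁻¹ * ∫⁻ x in ratIcc i, f x ∂ν

/-- The uncentred maximal function over rational intervals with respect to `ν`. -/
def maxFn (ν : Measure ℝ) (f : ℝ → ℝ≥0∞) (x : ℝ) : ℝ≥0∞ :=
  ⨆ i, (ratIcc i).indicator (fun _ => ratAvg ν i f) x

variable {ν : Measure ℝ}

/-- The supremum is over countably many intervals, so nothing is asked of `f`. -/
theorem measurable_maxFn (f : ℝ → ℝ≥0∞) : Measurable (maxFn ν f) :=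
  Measurable.iSup fun i => measurable_const.indicator (measurableSet_ratIcc i)

theorem ratAvg_le_maxFn {i : ℚ × ℚ} {x : ℝ} (hx : x ∈ ratIcc i) (f : ℝ → ℝ≥0∞) :
    ratAvg ν i f ≤ maxFn ν f x :=
  (by simp [hx] : ratAvg ν i f = (ratIcc i).indicator (fun _ => ratAvg ν i f) x).le.trans
    (le_iSup (fun i => (ratIcc i).indicator (fun _ => ratAvg ν i f) x) i)

theorem maxFn_le_iff {f : ℝ → ℝ≥0∞} {x : ℝ} {c : ℝ≥0∞} :
    maxFn ν f x ≤ c ↔ ∀ i, x ∈ ratIcc i → ratAvg ν i f ≤ c := by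
  refine ⟨fun h i hi => (ratAvg_le_maxFn hi f).trans h, fun h => iSup_le fun i => ?_⟩
  by_cases hi : x ∈ ratIcc i
  · simpa [hi] using h i hi
  · simp [hi]

theorem lt_maxFn_iff {f : ℝ → ℝ≥0∞} {x : ℝ} {c : ℝ≥0∞} :
    c < maxFn ν f x ↔ ∃ i, x ∈ ratIcc i ∧ c < ratAvg ν i f := by
  rw [← not_le, maxFn_le_iff]; push Not; rfl

theorem ratAvg_mono {i : ℚ × ℚ} {f g : ℝ → ℝ≥0∞} (h : ∀ x, f x ≤ g x) :
    ratAvg ν i f ≤ ratAvg ν i g := by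
  unfold ratAvg; gcongr; exact h _

theorem maxFn_mono {f g : ℝ → ℝ≥0∞} (h : ∀ x, f x ≤ g x) (x : ℝ) : maxFn ν f x ≤ maxFn ν g x :=
  maxFn_le_iff.2 fun _ hi => (ratAvg_mono h).trans (ratAvg_le_maxFn hi g)

theorem maxFn_tsum_le {f : ℕ → ℝ → ℝ≥0∞} (hf : ∀ l, Measurable (f l)) (x : ℝ) :
    maxFn ν (fun y => ∑' l, f l y) x ≤ ∑' l, maxFn ν (f l) x := by
  refine maxFn_le_iff.2 fun i hi => ?_
  rw [ratAvg, lintegral_tsum fun l => (hf l).aemeasurable, ← ENNReal.tsum_mul_left]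
  exact ENNReal.tsum_le_tsum fun l => ratAvg_le_maxFn hi (f l)

theorem maxFn_const_mul {c : ℝ≥0∞} (hc : c ≠ ∞) (f : ℝ → ℝ≥0∞) (x : ℝ) :
    maxFn ν (fun y => c * f y) x = c * maxFn ν f x := by
  rw [maxFn, maxFn, ENNReal.mul_iSup]
  congr 1
  ext i
  by_cases hi : x ∈ ratIcc i
  · simp only [ratAvg, hi, Set.indicator_of_mem, lintegral_const_mul' _ _ hc]; ring
  · simp [hi]

/-- The covering lemma on the line needs no doubling, so the constant 2 serves every measure. This
matters because the operator is used later with respect to w dx and to the dual weight. -/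
theorem maxFn_weak_type {f : ℝ → ℝ≥0∞} (hf : Measurable f) (l : ℝ≥0∞) :
    l * ν {x | l < maxFn ν f x} ≤ 2 * ∫⁻ x, f x ∂ν := by
  -- The level set is a directed union of finite unions of intervals with average above `l`, so it
  -- suffices to bound the measure of each finite union.
  have hset : {x | l < maxFn ν f x} = ⋃ s : Finset {i : ℚ × ℚ // l < ratAvg ν i f},
      ⋃ i ∈ s.image Subtype.val, ratIcc i := by
    ext x
    simp only [Set.mem_ofPred_eq, lt_maxFn_iff, Set.mem_iUnion]
    constructor
    · rintro ⟨i, hi, hl⟩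
      exact ⟨{⟨i, hl⟩}, i, by simp, hi⟩
    · rintro ⟨s, i, hi, hx⟩
      simp only [Finset.mem_image, Subtype.exists, exists_and_right, exists_eq_right] at hi
      exact ⟨i, hx, hi.1⟩
  rw [hset, Directed.measure_iUnion, ENNReal.mul_iSup]
  · refine iSup_le fun s => ?_
    obtain ⟨t, hts, hU, hov⟩ := exists_subcover_overlap_le_two (s.image Subtype.val)
    rw [hU]
    calc l * ν (⋃ i ∈ t, ratIcc i) ≤ l * ∑ i ∈ t, ν (ratIcc i) := by
          gcongr; exact measure_biUnion_finset_le _ _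
      _ = ∑ i ∈ t, l * ν (ratIcc i) := Finset.mul_sum _ _ _
      _ ≤ ∑ i ∈ t, ∫⁻ x in ratIcc i, f x ∂ν := by
          refine Finset.sum_le_sum fun i hi => ?_
          have hi := hts hi
          simp only [Finset.mem_image, Subtype.exists, exists_and_right, exists_eq_right] at hi
          obtain ⟨hl, _⟩ := hi
          by_cases h0 : ν (ratIcc i) = 0
          · simp [h0]
          by_cases h1 : ν (ratIcc i) = ∞
          -- Since ∞⁻¹ = 0, an interval of infinite measure has average 0, which cannot exceed `l`.
          · simp [ratAvg, h1] at hl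
          calc l * ν (ratIcc i) ≤ ratAvg ν i f * ν (ratIcc i) := by gcongr
            _ = _ := by
              rw [ratAvg, mul_comm, ← mul_assoc, ENNReal.mul_inv_cancel h0 h1, one_mul]
      _ = ∫⁻ x, f x * ∑ i ∈ t, (ratIcc i).indicator (fun _ => (1 : ℝ≥0∞)) x ∂ν := by
          simp_rw [← lintegral_indicator (measurableSet_ratIcc _), Finset.mul_sum]
          rw [← lintegral_finsetSum _ fun i _ => hf.indicator (measurableSet_ratIcc i)]
          congr 1; ext x
          refine Finset.sum_congr rfl fun i _ => ?_
          by_cases hx : x ∈ ratIcc i <;> simp [hx]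
      _ ≤ ∫⁻ x, f x * 2 ∂ν := lintegral_mono fun x => by gcongr; exact hov x
      _ = 2 * ∫⁻ x, f x ∂ν := by rw [lintegral_mul_const' _ _ (by simp), mul_comm]
  · refine Monotone.directed_le fun s s' h => ?_
    exact Set.biUnion_subset_biUnion_left fun i hi => Finset.image_subset_image h hi

/-- Only the part of f above l/2 matters: the remainder is at most l/2 and contributes at most l/2
to the maximal function. The weak type inequality at level l/2 then gives 2·2 = 4. -/
theorem maxFn_truncation_weak_type {f : ℝ → ℝ≥0∞} (hf : Measurable f) (l : ℝ) :
    ENNReal.ofReal l * ν {x | ENNReal.ofReal l < maxFn ν f x}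
      ≤ 4 * ∫⁻ x, (if ENNReal.ofReal l < 2 * f x then f x else 0) ∂ν := by
  set g : ℝ → ℝ≥0∞ := fun x => if ENNReal.ofReal l < 2 * f x then f x else 0 with hg
  have hgm : Measurable g :=
    Measurable.ite (measurableSet_lt measurable_const (hf.const_mul 2)) hf measurable_const
  have h2 : ENNReal.ofReal l = 2 * ENNReal.ofReal (l / 2) := by
    rw [← ENNReal.ofReal_ofNat 2, ← ENNReal.ofReal_mul (by norm_num)]; congr 1; ring
  have hfg : ∀ x, f x ≤ g x + ENNReal.ofReal (l / 2) := by
    intro x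
    by_cases h : ENNReal.ofReal l < 2 * f x
    · simp [hg, h]
    · simp only [hg, h, if_false, zero_add]
      rw [not_lt, h2] at h
      exact (ENNReal.mul_le_mul_iff_right (by simp) (by simp)).1 h
  have hM : ∀ x, maxFn ν f x ≤ maxFn ν g x + ENNReal.ofReal (l / 2) := by
    intro x
    refine maxFn_le_iff.2 fun i hi => (ratAvg_mono hfg).trans ?_
    rw [ratAvg, lintegral_add_left hgm, mul_add]
    refine add_le_add (ratAvg_le_maxFn hi g) ?_
    rw [lintegral_const, Measure.restrict_apply MeasurableSet.univ, Set.univ_inter, mul_left_comm]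
    exact mul_le_of_le_one_right' (ENNReal.inv_mul_le_one _)
  calc ENNReal.ofReal l * ν {x | ENNReal.ofReal l < maxFn ν f x}
      ≤ ENNReal.ofReal l * ν {x | ENNReal.ofReal (l / 2) < maxFn ν g x} := by
        refine mul_le_mul_right (measure_mono fun x h => ?_) _
        by_contra! h'
        refine absurd h (not_lt.2 ((hM x).trans ?_))
        rw [h2, two_mul]
        gcongr
        exact not_lt.1 h'
    _ = 2 * (ENNReal.ofReal (l / 2) * ν {x | ENNReal.ofReal (l / 2) < maxFn ν g x}) := by
        rw [h2, mul_assoc]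
    _ ≤ 2 * (2 * ∫⁻ x, g x ∂ν) := mul_le_mul_right (maxFn_weak_type hgm _) _
    _ = 4 * ∫⁻ x, g x ∂ν := by rw [← mul_assoc]; norm_num

/-- The constant in the strong type `(p, p)` inequality for `maxFn`. -/
def maxConst (p : ℝ) : ℝ≥0 := (4 * (p / (p - 1)) * 2 ^ (p - 1)).toNNReal

/-- Marcinkiewicz interpolation with L^∞: insert the truncated weak type bound in the layer cake
formula, exchange the integrals, and use the layer cake formula again for 2f with exponent p - 1. -/
theorem lintegral_maxFn_rpow_le [SFinite ν] {p : ℝ} (hp : 1 < p) {f : ℝ → ℝ≥0∞}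
    (hf : Measurable f) :
    ∫⁻ x, maxFn ν f x ^ p ∂ν ≤ maxConst p * ∫⁻ x, f x ^ p ∂ν := by
  have hp0 : 0 < p := by linarith
  have hp1 : 0 < p - 1 := by linarith
  calc ∫⁻ x, maxFn ν f x ^ p ∂ν
      = ∫⁻ x, ∫⁻ l in Set.Ioi (0 : ℝ), (if ENNReal.ofReal l < maxFn ν f x then
          ENNReal.ofReal (p * l ^ (p - 1)) else 0) ∂volume ∂ν := by
        simp_rw [lintegral_layer hp0]
    _ = ∫⁻ l in Set.Ioi (0 : ℝ), ∫⁻ x, (if ENNReal.ofReal l < maxFn ν f x then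
          ENNReal.ofReal (p * l ^ (p - 1)) else 0) ∂ν := by
        refine lintegral_lintegral_swap (Measurable.aemeasurable ?_)
        refine Measurable.ite (measurableSet_lt (by fun_prop)
          ((measurable_maxFn f).comp measurable_fst)) (by fun_prop) measurable_const
    _ ≤ ∫⁻ l in Set.Ioi (0 : ℝ), ∫⁻ x, (4 * ENNReal.ofReal (p / (p - 1))) * (f x *
          (if ENNReal.ofReal l < 2 * f x then
            ENNReal.ofReal ((p - 1) * l ^ (p - 1 - 1)) else 0)) ∂ν := by
        refine setLIntegral_mono' measurableSet_Ioi fun l hl => ?_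
        have hl : 0 < l := hl
        have e1 : ∀ x, (if ENNReal.ofReal l < maxFn ν f x then
            ENNReal.ofReal (p * l ^ (p - 1)) else 0) = {x | ENNReal.ofReal l < maxFn ν f x}.indicator
              (fun _ => ENNReal.ofReal (p * l ^ (p - 1))) x := fun x => by
          simp [Set.indicator]
        simp_rw [e1]
        rw [lintegral_indicator_const (measurableSet_lt measurable_const (measurable_maxFn f))]
        -- One power of `l` is split off to meet the factor in the weak type inequality.
        have e2 : ENNReal.ofReal (p * l ^ (p - 1))
            = ENNReal.ofReal (p * l ^ (p - 1 - 1)) * ENNReal.ofReal l := by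
          rw [← ENNReal.ofReal_mul (by positivity), mul_assoc, ← Real.rpow_add_one hl.ne', sub_add_cancel]
        rw [e2, mul_assoc]
        refine (mul_le_mul_right (maxFn_truncation_weak_type hf l) _).trans ?_
        rw [← mul_assoc, ← lintegral_const_mul' _ _ (by finiteness)]
        refine lintegral_mono fun x => ?_
        dsimp only
        split_ifs with h
        · refine le_of_eq ?_
          have e3 : p * l ^ (p - 1 - 1) = (p / (p - 1)) * ((p - 1) * l ^ (p - 1 - 1)) := by
            field_simp
          rw [e3, ENNReal.ofReal_mul (by positivity)]
          ring
        · simp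
    _ = (4 * ENNReal.ofReal (p / (p - 1))) * ∫⁻ x, f x * (2 * f x) ^ (p - 1) ∂ν := by
        rw [lintegral_lintegral_swap]
        · rw [← lintegral_const_mul' _ _ (by finiteness)]
          refine lintegral_congr fun x => ?_
          rw [lintegral_const_mul' _ _ (by finiteness), lintegral_const_mul, lintegral_layer hp1]
          exact Measurable.ite (measurableSet_lt (by fun_prop) measurable_const) (by fun_prop)
            measurable_const
        · refine Measurable.aemeasurable (Measurable.const_mul
            (Measurable.mul (by fun_prop) (Measurable.ite (measurableSet_lt (by fun_prop)
              (by fun_prop)) (by fun_prop) measurable_const)) _)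
    _ = maxConst p * ∫⁻ x, f x ^ p ∂ν := by
        have e4 : ∀ x, f x * (2 * f x) ^ (p - 1) = 2 ^ (p - 1) * f x ^ p := by
          intro x
          rw [ENNReal.mul_rpow_of_nonneg _ _ hp1.le, mul_left_comm]
          congr 1
          conv_lhs => rw [← ENNReal.rpow_one (f x), ← ENNReal.rpow_mul]
          rw [← ENNReal.rpow_add_of_nonneg _ _ (by norm_num) (by simpa using hp1.le)]
          congr 1; ring
        simp_rw [e4]
        rw [lintegral_const_mul' _ _ (by finiteness), ← mul_assoc]
        congr 1
        rw [maxConst, ← ENNReal.ofReal, ENNReal.ofReal_mul (by positivity),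
          ENNReal.ofReal_mul (by positivity), ENNReal.ofReal_ofNat,
          ← ENNReal.ofReal_rpow_of_pos (by norm_num), ENNReal.ofReal_ofNat]

end Maximal

/-! ### Muckenhoupt weights and Muckenhoupt's theorem. -/

/-- The dual weight `w^{1 - p'}` of a weight `w`, where `p'` is the exponent conjugate to `p`. -/
def dualWeight (p : ℝ) (w : ℝ → ℝ≥0∞) (x : ℝ) : ℝ≥0∞ := w x ^ (-(1 / (p - 1)))

/-- The Muckenhoupt condition `A_p` with constant `K`, over intervals with rational end points. -/
structure IsAp (p : ℝ) (K : ℝ≥0) (w : ℝ → ℝ≥0∞) : Prop where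
  measurable : Measurable w
  ne_zero : ∀ᵐ x, w x ≠ 0
  ne_top : ∀ᵐ x, w x ≠ ∞
  bound : ∀ i, ratAvg volume i w * ratAvg volume i (dualWeight p w) ^ (p - 1) ≤ K

theorem measurable_dualWeight {p : ℝ} {w : ℝ → ℝ≥0∞} (hw : Measurable w) :
    Measurable (dualWeight p w) := hw.pow_const _

theorem dualWeight_dualWeight {p : ℝ} (hp : 1 < p) (w : ℝ → ℝ≥0∞) :
    dualWeight (p / (p - 1)) (dualWeight p w) = w := by
  have hp1 : p - 1 ≠ 0 := by linarith
  ext x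
  rw [dualWeight, dualWeight, ← ENNReal.rpow_mul]
  have : -(1 / (p - 1)) * -(1 / (p / (p - 1) - 1)) = 1 := by
    have : p / (p - 1) - 1 = 1 / (p - 1) := by field_simp; ring
    rw [this]; field_simp
  rw [this, ENNReal.rpow_one]

theorem lintegral_withDensity_rpow {p : ℝ} {w F : ℝ → ℝ≥0∞} (hw : Measurable w)
    (hF : Measurable F) :
    ∫⁻ x, F x ^ p ∂(volume.withDensity w) = ∫⁻ x, F x ^ p * w x := by
  rw [lintegral_withDensity_eq_lintegral_mul _ hw (hF.pow_const p)]
  simp [mul_comm]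

theorem volume_ratIcc_ne_top (i : ℚ × ℚ) : volume (ratIcc i) ≠ ∞ := by
  simp [ratIcc]

theorem ratAvg_eq_zero_of_volume_eq_zero {i : ℚ × ℚ} (h : volume (ratIcc i) = 0)
    (f : ℝ → ℝ≥0∞) : ratAvg volume i f = 0 := by
  rw [ratAvg, setLIntegral_measure_zero _ _ h, mul_zero]

theorem ratAvg_ne_zero {i : ℚ × ℚ} (h : volume (ratIcc i) ≠ 0) {f : ℝ → ℝ≥0∞}
    (hf : Measurable f) (hpos : ∀ᵐ x, f x ≠ 0) : ratAvg volume i f ≠ 0 := by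
  rw [ratAvg, mul_ne_zero_iff]
  refine ⟨ENNReal.inv_ne_zero.2 (volume_ratIcc_ne_top i), fun h0 => h ?_⟩
  rw [lintegral_eq_zero_iff hf] at h0
  have : ∀ᵐ x ∂(volume.restrict (ratIcc i)), False := by
    filter_upwards [h0, ae_restrict_of_ae hpos] with x h1 h2 using h2 h1
  simpa using this

namespace IsAp

variable {p : ℝ} {K : ℝ≥0} {w : ℝ → ℝ≥0∞}

theorem dual_ne_zero (hw : IsAp p K w) : ∀ᵐ x, dualWeight p w x ≠ 0 := by
  filter_upwards [hw.ne_zero, hw.ne_top] with x h0 h1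
  exact (ENNReal.rpow_pos (pos_iff_ne_zero.2 h0) h1).ne'

theorem dual_ne_top (hw : IsAp p K w) : ∀ᵐ x, dualWeight p w x ≠ ∞ := by
  filter_upwards [hw.ne_zero, hw.ne_top] with x h0 h1
  exact ENNReal.rpow_ne_top_of_ne_zero h0 h1

/-- This is the `A_p` condition raised to the power 1/(p - 1), with the two factors exchanged. -/
theorem dual (hp : 1 < p) (hw : IsAp p K w) :
    IsAp (p / (p - 1)) (K ^ (1 / (p - 1))) (dualWeight p w) where
  measurable := measurable_dualWeight hw.measurable
  ne_zero := hw.dual_ne_zero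
  ne_top := hw.dual_ne_top
  bound i := by
    have hp1 : 0 < p - 1 := by linarith
    rw [dualWeight_dualWeight hp]
    have e : p / (p - 1) - 1 = 1 / (p - 1) := by field_simp; ring
    have h := ENNReal.rpow_le_rpow (hw.bound i) (by positivity : 0 ≤ 1 / (p - 1))
    rw [ENNReal.mul_rpow_of_nonneg _ _ (by positivity), ← ENNReal.rpow_mul,
      mul_one_div_cancel hp1.ne', ENNReal.rpow_one] at h
    rw [e, mul_comm, ENNReal.coe_rpow_of_nonneg _ (by positivity)]
    exact h

/-- Lerner's argument. Let σ be the dual weight and m the σ-average of f/σ over I. The average of f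
is (σ(I)/|I|)·m, and the `A_p` condition bounds (σ(I)/|I|)^{p-1} by K|I|/w(I). What remains, |I|
m^{p-1}/w(I), is at most the w-average over I of (M_σ(f/σ))^{p-1}/w. -/
theorem ratAvg_rpow_le (hp : 1 < p) (hw : IsAp p K w) {f : ℝ → ℝ≥0∞} (hf : Measurable f)
    {i : ℚ × ℚ} {x : ℝ} (hx : x ∈ ratIcc i) :
    ratAvg volume i f ^ (p - 1) ≤ K * maxFn (volume.withDensity w) (fun y =>
      maxFn (volume.withDensity (dualWeight p w)) (fun z => f z / dualWeight p w z) y ^ (p - 1)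
        / w y) x := by
  have hp1 : 0 < p - 1 := by linarith
  by_cases hV : volume (ratIcc i) = 0
  · rw [ratAvg_eq_zero_of_volume_eq_zero hV, ENNReal.zero_rpow_of_pos hp1]; exact zero_le
  set V := volume (ratIcc i) with hVdef
  have hVt : V ≠ ∞ := volume_ratIcc_ne_top i
  set σ := dualWeight p w with hσ
  have hσm : Measurable σ := measurable_dualWeight hw.measurable
  set g : ℝ → ℝ≥0∞ := fun z => f z / σ z with hg
  have hgm : Measurable g := hf.div hσm
  set Mg := maxFn (volume.withDensity σ) g with hMg
  have hMgm : Measurable Mg := measurable_maxFn _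
  set W := ∫⁻ x in ratIcc i, w x with hW
  set S := ∫⁻ x in ratIcc i, σ x with hS
  have hWa : ratAvg volume i w = V⁻¹ * W := rfl
  have hSa : ratAvg volume i σ = V⁻¹ * S := rfl
  have hW0 : V⁻¹ * W ≠ 0 := ratAvg_ne_zero hV hw.measurable hw.ne_zero
  have hS0 : V⁻¹ * S ≠ 0 := ratAvg_ne_zero hV hσm hw.dual_ne_zero
  have hb := hw.bound i
  rw [hWa, ← hσ, hSa] at hb
  have hbt := ne_top_of_le_ne_top ENNReal.coe_ne_top hb
  -- Both averages are nonzero and the `A_p` product is finite, so neither can be infinite.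
  have hSt : V⁻¹ * S ≠ ∞ := by
    intro h
    rw [h, ENNReal.top_rpow_of_pos hp1, ENNReal.mul_top hW0] at hbt
    exact hbt rfl
  have hWt : V⁻¹ * W ≠ ∞ := by
    intro h
    rw [h, ENNReal.top_mul] at hbt
    · exact hbt rfl
    · exact (ENNReal.rpow_pos (pos_iff_ne_zero.2 hS0) hSt).ne'
  have hW0' : W ≠ 0 := right_ne_zero_of_mul hW0
  have hS0' : S ≠ 0 := right_ne_zero_of_mul hS0
  have hWt' : W ≠ ∞ := fun h => hWt (by
    rw [h, ENNReal.mul_top (ENNReal.inv_ne_zero.2 hVt)])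
  have hSt' : S ≠ ∞ := fun h => hSt (by
    rw [h, ENNReal.mul_top (ENNReal.inv_ne_zero.2 hVt)])
  have hσi : volume.withDensity σ (ratIcc i) = S :=
    withDensity_apply _ (measurableSet_ratIcc i)
  have hwi : volume.withDensity w (ratIcc i) = W :=
    withDensity_apply _ (measurableSet_ratIcc i)
  have hgint : ∫⁻ x in ratIcc i, g x ∂(volume.withDensity σ) = ∫⁻ x in ratIcc i, f x := by
    rw [restrict_withDensity (measurableSet_ratIcc i),
      lintegral_withDensity_eq_lintegral_mul _ hσm hgm]
    refine lintegral_congr_ae (ae_restrict_of_ae ?_)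
    filter_upwards [hw.dual_ne_zero, hw.dual_ne_top] with y h0 h1
    exact ENNReal.mul_div_cancel h0 h1
  set m := ratAvg (volume.withDensity σ) i g with hm
  have hmf : ratAvg volume i f = V⁻¹ * S * m := by
    rw [hm, ratAvg, ratAvg, hgint, hσi, mul_assoc, ← mul_assoc S,
      ENNReal.mul_inv_cancel hS0' hSt', one_mul]
  have hVm : W⁻¹ * (V * m ^ (p - 1)) ≤ ratAvg (volume.withDensity w) i
      (fun y => Mg y ^ (p - 1) / w y) := by
    rw [ratAvg, hwi]
    refine mul_le_mul_right ?_ _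
    rw [restrict_withDensity (measurableSet_ratIcc i),
      lintegral_withDensity_eq_lintegral_mul _ hw.measurable
        (show Measurable fun y => Mg y ^ (p - 1) / w y from (hMgm.pow_const _).div hw.measurable)]
    calc V * m ^ (p - 1) = ∫⁻ y in ratIcc i, m ^ (p - 1) := by
          rw [lintegral_const, Measure.restrict_apply MeasurableSet.univ, Set.univ_inter, mul_comm]
      _ ≤ ∫⁻ y in ratIcc i, Mg y ^ (p - 1) :=
          setLIntegral_mono (hMgm.pow_const _) fun y hy =>
            ENNReal.rpow_le_rpow (ratAvg_le_maxFn hy g) hp1.le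
      _ = _ := by
          refine lintegral_congr_ae (ae_restrict_of_ae ?_)
          filter_upwards [hw.ne_zero, hw.ne_top] with y h0 h1
          exact (ENNReal.mul_div_cancel h0 h1).symm
  rw [hmf, ENNReal.mul_rpow_of_nonneg _ _ hp1.le]
  calc (V⁻¹ * S) ^ (p - 1) * m ^ (p - 1)
      = (V⁻¹ * W * (V⁻¹ * S) ^ (p - 1)) * (W⁻¹ * (V * m ^ (p - 1))) := by
        have : V⁻¹ * W * (W⁻¹ * V) = 1 := by
          rw [mul_assoc, ← mul_assoc W, ENNReal.mul_inv_cancel hW0' hWt', one_mul,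
            ENNReal.inv_mul_cancel hV hVt]
        calc _ = (V⁻¹ * W * (W⁻¹ * V)) * ((V⁻¹ * S) ^ (p - 1) * m ^ (p - 1)) := by
              rw [this, one_mul]
          _ = _ := by ring
    _ ≤ K * ratAvg (volume.withDensity w) i (fun y => Mg y ^ (p - 1) / w y) :=
        mul_le_mul' hb hVm
    _ ≤ _ := mul_le_mul_right (ratAvg_le_maxFn hx _) _

end IsAp

/-- The constant in Muckenhoupt's theorem. -/
def muckConst (p : ℝ) (K : ℝ≥0) : ℝ≥0 :=
  K ^ (p / (p - 1)) * (maxConst (p / (p - 1)) * maxConst p)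

/-- **Muckenhoupt's theorem**: the maximal operator is bounded on `L^p(w)` for `w ∈ A_p`. -/
theorem IsAp.lintegral_maxFn_rpow_le {p : ℝ} {K : ℝ≥0} {w : ℝ → ℝ≥0∞} (hp : 1 < p)
    (hw : IsAp p K w) {f : ℝ → ℝ≥0∞} (hf : Measurable f) :
    ∫⁻ x, maxFn volume f x ^ p ∂(volume.withDensity w)
      ≤ muckConst p K * ∫⁻ x, f x ^ p ∂(volume.withDensity w) := by
  have hp1 : 0 < p - 1 := by linarith
  have hp0 : 0 < p := by linarith
  have hq : 1 < p / (p - 1) := by rw [lt_div_iff₀ hp1]; linarith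
  have hq0 : 0 < p / (p - 1) := by linarith
  have hwm := hw.measurable
  have hσm : Measurable (dualWeight p w) := measurable_dualWeight hwm
  have hgm : Measurable (fun z => f z / dualWeight p w z) := hf.div hσm
  set Mg := maxFn (volume.withDensity (dualWeight p w)) (fun z => f z / dualWeight p w z) with hMg
  have hMgm : Measurable Mg := measurable_maxFn _
  set h : ℝ → ℝ≥0∞ := fun y => Mg y ^ (p - 1) / w y with hh
  have hhm : Measurable h := (hMgm.pow_const _).div hwm
  have key : ∀ x, maxFn volume f x ^ p ≤
      (K : ℝ≥0∞) ^ (p / (p - 1)) * maxFn (volume.withDensity w) h x ^ (p / (p - 1)) := by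
    intro x
    have h1 : maxFn volume f x ^ (p - 1) ≤ K * maxFn (volume.withDensity w) h x := by
      rw [← ENNReal.le_rpow_inv_iff hp1, maxFn_le_iff]
      intro i hi
      rw [ENNReal.le_rpow_inv_iff hp1]
      exact hw.ratAvg_rpow_le hp hf hi
    have h2 := ENNReal.rpow_le_rpow h1 hq0.le
    rwa [← ENNReal.rpow_mul, mul_div_cancel₀ _ hp1.ne', ENNReal.mul_rpow_of_nonneg _ _ hq0.le]
      at h2
  -- With q = p/(p - 1): apply boundedness of M_w on L^q(w), then h^q w = (M_σ(f/σ))^p σ, then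
  -- boundedness of M_σ on L^p(σ), and finally (f/σ)^p σ = f^p w.
  calc ∫⁻ x, maxFn volume f x ^ p ∂(volume.withDensity w)
      ≤ ∫⁻ x, (K : ℝ≥0∞) ^ (p / (p - 1)) *
          maxFn (volume.withDensity w) h x ^ (p / (p - 1)) ∂(volume.withDensity w) :=
        lintegral_mono key
    _ = (K : ℝ≥0∞) ^ (p / (p - 1)) * ∫⁻ x, maxFn (volume.withDensity w) h x ^ (p / (p - 1))
          ∂(volume.withDensity w) :=
        lintegral_const_mul' _ _ (ENNReal.rpow_ne_top_of_nonneg hq0.le ENNReal.coe_ne_top)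
    _ ≤ (K : ℝ≥0∞) ^ (p / (p - 1)) * (maxConst (p / (p - 1)) * ∫⁻ x, h x ^ (p / (p - 1))
          ∂(volume.withDensity w)) := by
        gcongr; exact _root_.lintegral_maxFn_rpow_le hq hhm
    _ = (K : ℝ≥0∞) ^ (p / (p - 1)) * (maxConst (p / (p - 1)) * ∫⁻ x, Mg x ^ p
          ∂(volume.withDensity (dualWeight p w))) := by
        rw [lintegral_withDensity_rpow hwm hhm, lintegral_withDensity_rpow hσm hMgm]
        congr 2
        refine lintegral_congr_ae ?_
        filter_upwards [hw.ne_zero, hw.ne_top] with x h0 h1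
        change (Mg x ^ (p - 1) / w x) ^ (p / (p - 1)) * w x = Mg x ^ p * w x ^ (-(1 / (p - 1)))
        have e : w x ^ (-(p / (p - 1))) * w x = w x ^ (-(1 / (p - 1))) := by
          conv_lhs => rw [← ENNReal.rpow_one (w x), ← ENNReal.rpow_mul]
          rw [← ENNReal.rpow_add _ _ h0 h1]
          congr 1; field_simp; ring
        rw [ENNReal.div_rpow_of_nonneg _ _ hq0.le, ENNReal.div_eq_inv_mul, ← ENNReal.rpow_neg,
          ← ENNReal.rpow_mul, mul_div_cancel₀ _ hp1.ne', ← e]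
        ring
    _ ≤ (K : ℝ≥0∞) ^ (p / (p - 1)) * (maxConst (p / (p - 1)) * (maxConst p *
          ∫⁻ x, (f x / dualWeight p w x) ^ p ∂(volume.withDensity (dualWeight p w)))) := by
        gcongr; exact _root_.lintegral_maxFn_rpow_le hp hgm
    _ = muckConst p K * ∫⁻ x, f x ^ p ∂(volume.withDensity w) := by
        rw [lintegral_withDensity_rpow hσm hgm, lintegral_withDensity_rpow hwm hf, muckConst]
        push_cast
        rw [ENNReal.coe_rpow_of_nonneg _ hq0.le, mul_assoc, mul_assoc]
        congr 3
        refine lintegral_congr_ae ?_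
        filter_upwards [hw.ne_zero, hw.ne_top] with x h0 h1
        change (f x / w x ^ (-(1 / (p - 1)))) ^ p * w x ^ (-(1 / (p - 1))) = f x ^ p * w x
        have e : w x ^ (1 / (p - 1) * p) * w x ^ (-(1 / (p - 1))) = w x := by
          rw [← ENNReal.rpow_add _ _ h0 h1]
          conv_rhs => rw [← ENNReal.rpow_one (w x)]
          congr 1; field_simp; ring
        rw [ENNReal.div_eq_inv_mul, ← ENNReal.rpow_neg, neg_neg,
          ENNReal.mul_rpow_of_nonneg _ _ hp0.le, ← ENNReal.rpow_mul]
        conv_rhs => rw [← e]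
        ring

/-! ### The Rubio de Francia algorithm and products of A_1 weights. -/

/-- The constant in the `A_1` condition produced by the Rubio de Francia algorithm. -/
def rdfConst (p : ℝ) (K : ℝ≥0) : ℝ≥0 := 2 * (muckConst p K ^ (1 / p) + 1)

/-- The **Rubio de Francia algorithm**. -/
theorem IsAp.exists_majorant {p : ℝ} {K : ℝ≥0} {w : ℝ → ℝ≥0∞} (hp : 1 < p)
    (hw : IsAp p K w) {g : ℝ → ℝ≥0∞} (hg : Measurable g) :
    ∃ H : ℝ → ℝ≥0∞, Measurable H ∧ (∀ x, g x ≤ H x) ∧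
      powNorm (volume.withDensity w) p H ≤ 2 * powNorm (volume.withDensity w) p g ∧
      ∀ x, maxFn volume H x ≤ rdfConst p K * H x := by
  have hp0 : 0 < p := by linarith
  set N : ℝ≥0 := muckConst p K ^ (1 / p) + 1 with hN
  have hN0 : N ≠ 0 := by positivity
  set ν := volume.withDensity w
  have hMN : ∀ f : ℝ → ℝ≥0∞, Measurable f →
      powNorm ν p (maxFn volume f) ≤ N * powNorm ν p f := by
    intro f hf
    rw [powNorm_le_iff hp0, ENNReal.mul_rpow_of_nonneg _ _ hp0.le, powNorm_rpow hp0]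
    refine (hw.lintegral_maxFn_rpow_le hp hf).trans ?_
    gcongr
    rw [← ENNReal.coe_rpow_of_nonneg _ hp0.le, ENNReal.coe_le_coe]
    calc muckConst p K = (muckConst p K ^ (1 / p)) ^ p := by
          rw [← NNReal.rpow_mul, one_div_mul_cancel hp0.ne', NNReal.rpow_one]
      _ ≤ N ^ p := NNReal.rpow_le_rpow (by simp [hN]) hp0.le
  set I : ℕ → ℝ → ℝ≥0∞ := fun k => (maxFn volume)^[k] g with hI
  have hIs : ∀ k, I (k + 1) = maxFn volume (I k) := fun k => Function.iterate_succ_apply' _ _ _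
  have hIm : ∀ k, Measurable (I k) := by
    intro k
    cases k with
    | zero => exact hg
    | succ k => rw [hIs]; exact measurable_maxFn _
  have hIn : ∀ k, powNorm ν p (I k) ≤ N ^ k * powNorm ν p g := by
    intro k
    induction k with
    | zero => simp [hI]
    | succ k ih =>
      rw [hIs, pow_succ', mul_assoc]
      exact (hMN _ (hIm k)).trans (mul_le_mul_right ih _)
  -- The majorant is the series of `c ^ k` times the k-th iterate of the maximal operator on `g`. As
  -- `N` bounds the operator norm, the norms of the terms decay like 2^{-k}.
  set c : ℝ≥0 := (2 * N)⁻¹ with hc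
  have hcN : 2 * N * c = 1 := mul_inv_cancel₀ (by positivity)
  have hm : ∀ k, Measurable fun x => ((c ^ k : ℝ≥0) : ℝ≥0∞) * I k x :=
    fun k => (hIm k).const_mul _
  refine ⟨fun x => ∑' k, ((c ^ k : ℝ≥0) : ℝ≥0∞) * I k x, Measurable.tsum hm, fun x => ?_,
    ?_, fun x => ?_⟩
  · refine le_trans ?_ (ENNReal.le_tsum 0)
    simp [hI]
  · refine (powNorm_tsum_le hp.le hm).trans ?_
    calc ∑' k, powNorm ν p (fun x => ((c ^ k : ℝ≥0) : ℝ≥0∞) * I k x)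
        ≤ ∑' k : ℕ, (2 : ℝ≥0∞)⁻¹ ^ k * powNorm ν p g := by
          refine ENNReal.tsum_le_tsum fun k => ?_
          rw [powNorm_const_mul hp0 ENNReal.coe_ne_top]
          refine (mul_le_mul_right (hIn k) _).trans (le_of_eq ?_)
          rw [← mul_assoc]
          congr 1
          have : c * N = 2⁻¹ := by rw [hc]; field_simp
          rw [← ENNReal.coe_pow, ← ENNReal.coe_mul, ← mul_pow, this]
          push_cast
          rfl
      _ = 2 * powNorm ν p g := by
          rw [ENNReal.tsum_mul_right, ENNReal.tsum_geometric]
          simp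
  · refine (maxFn_tsum_le hm x).trans ?_
    rw [← ENNReal.tsum_mul_left]
    calc ∑' k, maxFn volume (fun y => ((c ^ k : ℝ≥0) : ℝ≥0∞) * I k y) x
        = ∑' k, (rdfConst p K : ℝ≥0∞) * (((c ^ (k + 1) : ℝ≥0) : ℝ≥0∞) * I (k + 1) x) := by
          congr 1; ext k
          rw [maxFn_const_mul ENNReal.coe_ne_top, hIs, ← mul_assoc, ← ENNReal.coe_mul, pow_succ',
            rdfConst, ← hN, ← mul_assoc, hcN, one_mul]
      -- The maximal operator shifts the series by one index, at the price 1/c = 2N = `rdfConst p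
      -- K`; the missing term k = 0 is nonnegative.
      _ ≤ _ := ENNReal.tsum_comp_le_tsum_of_injective (add_left_injective 1)
          (fun k => (rdfConst p K : ℝ≥0∞) * (((c ^ k : ℝ≥0) : ℝ≥0∞) * I k x))

/-- The easy half of the factorization of A_q weights. On an interval the A_1 conditions bound each
average of H_i by C_i H_i pointwise, so H₂^{1-q}, and H₁^{-1/(q-1)} in the dual weight, can be
replaced by powers of averages. The powers of the averages then cancel. -/
theorem isAp_mul_rpow {q : ℝ} (hq : 1 < q) {C₁ C₂ : ℝ≥0} {H₁ H₂ : ℝ → ℝ≥0∞}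
    (hm₁ : Measurable H₁) (hm₂ : Measurable H₂) (h₁0 : ∀ᵐ x, H₁ x ≠ 0) (h₂0 : ∀ᵐ x, H₂ x ≠ 0)
    (h₁t : ∀ᵐ x, H₁ x ≠ ∞) (h₂t : ∀ᵐ x, H₂ x ≠ ∞)
    (hM₁ : ∀ x, maxFn volume H₁ x ≤ C₁ * H₁ x) (hM₂ : ∀ x, maxFn volume H₂ x ≤ C₂ * H₂ x) :
    IsAp q (C₁ * C₂ ^ (q - 1)) (fun x => H₁ x * H₂ x ^ (1 - q)) where
  measurable := hm₁.mul (hm₂.pow_const _)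
  ne_zero := by
    filter_upwards [h₁0, h₂0, h₂t] with x h1 h2 h3
    exact mul_ne_zero h1 (ENNReal.rpow_pos (pos_iff_ne_zero.2 h2) h3).ne'
  ne_top := by
    filter_upwards [h₁t, h₂0, h₂t] with x h1 h2 h3
    exact ENNReal.mul_ne_top h1 (ENNReal.rpow_ne_top_of_ne_zero h2 h3)
  bound i := by
    have hq1 : 0 < q - 1 := by linarith
    by_cases hV : volume (ratIcc i) = 0
    · rw [ratAvg_eq_zero_of_volume_eq_zero hV, zero_mul]; exact zero_le
    set a := ratAvg volume i H₁ with ha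
    set b := ratAvg volume i H₂ with hb
    have ha0 : a ≠ 0 := ratAvg_ne_zero hV hm₁ h₁0
    have hb0 : b ≠ 0 := ratAvg_ne_zero hV hm₂ h₂0
    -- The A_1 inequality at a single point of the interval where `H` is finite already bounds the
    -- average.
    have hfin : ∀ {H : ℝ → ℝ≥0∞} {C : ℝ≥0}, (∀ᵐ x, H x ≠ ∞) →
        (∀ x, maxFn volume H x ≤ C * H x) → ratAvg volume i H ≠ ∞ := by
      intro H C hHt hH
      have : (ae (volume.restrict (ratIcc i))).NeBot := by
        rw [ae_neBot]; simpa using hV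
      obtain ⟨x, hx, hxt⟩ := ((ae_restrict_mem (measurableSet_ratIcc i)).and
        (ae_restrict_of_ae hHt)).exists
      exact ne_top_of_le_ne_top (ENNReal.mul_ne_top ENNReal.coe_ne_top hxt)
        ((ratAvg_le_maxFn hx H).trans (hH x))
    have hat : a ≠ ∞ := hfin h₁t hM₁
    have hbt : b ≠ ∞ := hfin h₂t hM₂
    have mul_avg : ∀ {c d : ℝ≥0∞} {f g : ℝ → ℝ≥0∞}, Measurable f → Measurable g →
        (∀ᵐ x, x ∈ ratIcc i → c * f x ≤ d * g x) →
        c * ratAvg volume i f ≤ d * ratAvg volume i g := by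
      intro c d f g hf hg h
      rw [ratAvg, ratAvg, mul_left_comm, mul_left_comm d, ← lintegral_const_mul _ hf,
        ← lintegral_const_mul _ hg]
      gcongr 1
      exact lintegral_mono_ae ((ae_restrict_iff' (measurableSet_ratIcc i)).2 h)
    have e1 : b ^ (q - 1) * ratAvg volume i (fun x => H₁ x * H₂ x ^ (1 - q))
        ≤ (C₂ : ℝ≥0∞) ^ (q - 1) * a := by
      refine mul_avg (hm₁.mul (hm₂.pow_const _)) hm₁ ?_
      filter_upwards [h₂0, h₂t] with x h0 ht hx
      have h1 : b ^ (q - 1) ≤ (C₂ : ℝ≥0∞) ^ (q - 1) * H₂ x ^ (q - 1) := by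
        rw [← ENNReal.mul_rpow_of_nonneg _ _ hq1.le]
        exact ENNReal.rpow_le_rpow ((ratAvg_le_maxFn hx _).trans (hM₂ x)) hq1.le
      calc b ^ (q - 1) * (H₁ x * H₂ x ^ (1 - q))
          ≤ (C₂ : ℝ≥0∞) ^ (q - 1) * H₂ x ^ (q - 1) * (H₁ x * H₂ x ^ (1 - q)) := by gcongr
        _ = (C₂ : ℝ≥0∞) ^ (q - 1) * H₁ x * (H₂ x ^ (q - 1) * H₂ x ^ (1 - q)) := by ring
        _ = (C₂ : ℝ≥0∞) ^ (q - 1) * H₁ x := by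
          rw [← ENNReal.rpow_add _ _ h0 ht]; simp
    set D := ratAvg volume i (dualWeight q fun x => H₁ x * H₂ x ^ (1 - q)) with hD
    have e2 : a ^ (1 / (q - 1)) * D ≤ (C₁ : ℝ≥0∞) ^ (1 / (q - 1)) * b := by
      refine mul_avg (measurable_dualWeight (hm₁.mul (hm₂.pow_const _))) hm₂ ?_
      filter_upwards [h₁0, h₁t, h₂0, h₂t] with x h0 ht h20 h2t hx
      have hr : 0 ≤ 1 / (q - 1) := by positivity
      have h1 : a ^ (1 / (q - 1)) ≤ (C₁ : ℝ≥0∞) ^ (1 / (q - 1)) * H₁ x ^ (1 / (q - 1)) := by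
        rw [← ENNReal.mul_rpow_of_nonneg _ _ hr]
        exact ENNReal.rpow_le_rpow ((ratAvg_le_maxFn hx _).trans (hM₁ x)) hr
      have h2 : dualWeight q (fun x => H₁ x * H₂ x ^ (1 - q)) x
          = H₁ x ^ (-(1 / (q - 1))) * H₂ x := by
        rw [dualWeight, ENNReal.mul_rpow_of_ne_top ht (ENNReal.rpow_ne_top_of_ne_zero h20 h2t),
          ← ENNReal.rpow_mul]
        congr 1
        conv_rhs => rw [← ENNReal.rpow_one (H₂ x)]
        congr 1; field_simp; ring
      rw [h2]
      calc a ^ (1 / (q - 1)) * (H₁ x ^ (-(1 / (q - 1))) * H₂ x)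
          ≤ (C₁ : ℝ≥0∞) ^ (1 / (q - 1)) * H₁ x ^ (1 / (q - 1)) *
            (H₁ x ^ (-(1 / (q - 1))) * H₂ x) := by gcongr
        _ = (C₁ : ℝ≥0∞) ^ (1 / (q - 1)) * H₂ x *
            (H₁ x ^ (1 / (q - 1)) * H₁ x ^ (-(1 / (q - 1)))) := by ring
        _ = (C₁ : ℝ≥0∞) ^ (1 / (q - 1)) * H₂ x := by
          rw [← ENNReal.rpow_add _ _ h0 ht]; simp
    have e3 : a * D ^ (q - 1) ≤ C₁ * b ^ (q - 1) := by
      have := ENNReal.rpow_le_rpow e2 hq1.le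
      rwa [ENNReal.mul_rpow_of_nonneg _ _ hq1.le, ENNReal.mul_rpow_of_nonneg _ _ hq1.le,
        ← ENNReal.rpow_mul, ← ENNReal.rpow_mul, one_div_mul_cancel hq1.ne', ENNReal.rpow_one,
        ENNReal.rpow_one] at this
    have e4 := mul_le_mul' e1 e3
    have hb0' : b ^ (q - 1) ≠ 0 := (ENNReal.rpow_pos (pos_iff_ne_zero.2 hb0) hbt).ne'
    have hbt' : b ^ (q - 1) ≠ ∞ := ENNReal.rpow_ne_top_of_ne_zero hb0 hbt
    refine (ENNReal.mul_le_mul_iff_right (mul_ne_zero hb0' ha0)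
      (ENNReal.mul_ne_top hbt' hat)).1 ?_
    push_cast
    rw [ENNReal.coe_rpow_of_nonneg _ hq1.le]
    calc _ = _ := by ring
      _ ≤ _ := e4
      _ = _ := by ring

/-! ### Extrapolation. -/

/-- The pair `(F, G)` satisfies weighted norm inequalities with constants `C p K` for all
Muckenhoupt weights. -/
def IsDominated (C : ℝ → ℝ≥0 → ℝ≥0) (F G : ℝ → ℝ≥0∞) : Prop :=
  ∀ p, 1 < p → ∀ K w, IsAp p K w →
    ∫⁻ x, F x ^ p ∂(volume.withDensity w) ≤ C p K * ∫⁻ x, G x ^ p ∂(volume.withDensity w)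

/-- The `A_q` constant of the weight used in extrapolating from `q` to `p`. -/
def extrapApConst (q p : ℝ) (K : ℝ≥0) : ℝ≥0 :=
  rdfConst (p / (p - 1)) (K ^ (1 / (p - 1))) * rdfConst p K ^ (q - 1)

/-- Let `Hg` be the majorant of G in L^p(w), and `Hf` that of F^{p-1}w in L^{p'}(w^{1-p'}). Then v =
Hf·Hg^{1-q} is in A_q, and ∫F^p w ≤ ∫F·Hf. Hölder's inequality, splitting F·Hf as (F^q
v)^{1/q}(Hg·Hf)^{1-1/q}, brings in the hypothesis at exponent q and leaves ∫Hg·Hf, which Hölder's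
inequality bounds by 4 B^{1/p} A^{1/p'}. No distinction between p < q and p > q is needed. -/
theorem extrapolation_of_pos {q p : ℝ} (hq : 1 < q) (hp : 1 < p) {K D : ℝ≥0} {w : ℝ → ℝ≥0∞}
    (hD0 : D ≠ 0) (hw : IsAp p K w) {F G : ℝ → ℝ≥0∞} (hF : Measurable F) (hG : Measurable G)
    (hF0 : ∀ x, F x ≠ 0) (hG0 : ∀ x, G x ≠ 0)
    (hA : ∫⁻ x, F x ^ p ∂(volume.withDensity w) ≠ ∞)
    (h : ∀ v, IsAp q (extrapApConst q p K) v →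
      ∫⁻ x, F x ^ q ∂(volume.withDensity v) ≤ D * ∫⁻ x, G x ^ q ∂(volume.withDensity v)) :
    ∫⁻ x, F x ^ p ∂(volume.withDensity w)
      ≤ ((4 * D ^ (1 / q)) ^ p : ℝ≥0) * ∫⁻ x, G x ^ p ∂(volume.withDensity w) := by
  have hp0 : 0 < p := by linarith
  have hp1 : 0 < p - 1 := by linarith
  have hq0 : 0 < q := by linarith
  have hp'0 : 0 < p / (p - 1) := by positivity
  have hp' : 1 < p / (p - 1) := by rw [lt_div_iff₀ hp1]; linarith
  have hwm := hw.measurable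
  set A := ∫⁻ x, F x ^ p ∂(volume.withDensity w) with hAdef
  set B := ∫⁻ x, G x ^ p ∂(volume.withDensity w) with hBdef
  by_cases hA0 : A = 0
  · rw [hA0]; exact zero_le
  by_cases hBt : B = ∞
  · rw [hBt, ENNReal.mul_top]
    · exact le_top
    · positivity
  obtain ⟨Hg, hgm, hgG, hgn, hgM⟩ := hw.exists_majorant hp hG
  set φ : ℝ → ℝ≥0∞ := fun x => F x ^ (p - 1) * w x with hφ
  have hφm : Measurable φ := (hF.pow_const _).mul hwm
  obtain ⟨Hf, hfm, hfφ, hfn, hfM⟩ := (hw.dual hp).exists_majorant hp' hφm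
  have hFt : ∀ᵐ x, F x ≠ ∞ := by
    rw [hAdef, lintegral_withDensity_rpow hwm hF] at hA
    filter_upwards [ae_lt_top ((hF.pow_const p).mul hwm) hA, hw.ne_zero] with x hx h0 hFx
    simp [hFx, ENNReal.top_rpow_of_pos hp0, ENNReal.top_mul h0] at hx
  have hφA : ∫⁻ x, φ x ^ (p / (p - 1)) ∂(volume.withDensity (dualWeight p w)) = A := by
    rw [lintegral_withDensity_rpow (measurable_dualWeight hwm) hφm, hAdef,
      lintegral_withDensity_rpow hwm hF]
    refine lintegral_congr_ae ?_
    filter_upwards [hw.ne_zero, hw.ne_top] with x h0 h1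
    change (F x ^ (p - 1) * w x) ^ (p / (p - 1)) * w x ^ (-(1 / (p - 1))) = F x ^ p * w x
    have e : w x ^ (p / (p - 1)) * w x ^ (-(1 / (p - 1))) = w x := by
      rw [← ENNReal.rpow_add _ _ h0 h1]
      conv_rhs => rw [← ENNReal.rpow_one (w x)]
      congr 1; field_simp; ring
    rw [ENNReal.mul_rpow_of_nonneg _ _ hp'0.le, ← ENNReal.rpow_mul, mul_div_cancel₀ _ hp1.ne']
    conv_rhs => rw [← e]
    ring
  have hgn' : (∫⁻ x, Hg x ^ p ∂(volume.withDensity w)) ^ (1 / p) ≤ 2 * B ^ (1 / p) := hgn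
  have hfn' : (∫⁻ x, Hf x ^ (p / (p - 1)) ∂(volume.withDensity (dualWeight p w)))
      ^ (1 / (p / (p - 1))) ≤ 2 * A ^ (1 / (p / (p - 1))) := by
    have := hfn
    rwa [powNorm, powNorm, hφA] at this
  have fin_of : ∀ {H v : ℝ → ℝ≥0∞} {s : ℝ}, 0 < s → Measurable H → Measurable v →
      (∀ᵐ x, v x ≠ 0) → (∫⁻ x, H x ^ s ∂(volume.withDensity v)) ^ (1 / s) ≠ ∞ →
      ∀ᵐ x, H x ≠ ∞ := by
    intro H v s hs hH hv hv0 hfin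
    have h1 : ∫⁻ x, H x ^ s ∂(volume.withDensity v) ≠ ∞ := by
      intro h; rw [h, ENNReal.top_rpow_of_pos (by positivity)] at hfin; exact hfin rfl
    rw [lintegral_withDensity_rpow hv hH] at h1
    filter_upwards [ae_lt_top ((hH.pow_const s).mul hv) h1, hv0] with x hx h0 hFx
    simp [hFx, ENNReal.top_rpow_of_pos hs, ENNReal.top_mul h0] at hx
  have hgt : ∀ᵐ x, Hg x ≠ ∞ := fin_of hp0 hgm hwm hw.ne_zero
    (ne_top_of_le_ne_top (ENNReal.mul_ne_top (by simp)
      (ENNReal.rpow_ne_top_of_nonneg (by positivity) hBt)) hgn')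
  have hft : ∀ᵐ x, Hf x ≠ ∞ := fin_of hp'0 hfm (measurable_dualWeight hwm) hw.dual_ne_zero
    (ne_top_of_le_ne_top (ENNReal.mul_ne_top (by simp)
      (ENNReal.rpow_ne_top_of_nonneg (by positivity) hA)) hfn')
  have hg0 : ∀ x, Hg x ≠ 0 := fun x hx => hG0 x (le_antisymm (hx ▸ hgG x) zero_le)
  have hf0 : ∀ᵐ x, Hf x ≠ 0 := by
    filter_upwards [hw.ne_zero, hFt] with x h0 hF1 hx
    have : φ x ≤ 0 := hx ▸ hfφ x
    exact (mul_ne_zero (ENNReal.rpow_pos (pos_iff_ne_zero.2 (hF0 x)) hF1).ne' h0)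
      (le_antisymm this zero_le)
  set v : ℝ → ℝ≥0∞ := fun x => Hf x * Hg x ^ (1 - q) with hv
  have hvm : Measurable v := hfm.mul (hgm.pow_const _)
  have hvA : IsAp q (extrapApConst q p K) v :=
    isAp_mul_rpow hq hfm hgm hf0 (Filter.Eventually.of_forall hg0) hft hgt hfM hgM
  set X := ∫⁻ x, Hg x * Hf x with hX
  have hGX : ∫⁻ x, G x ^ q ∂(volume.withDensity v) ≤ X := by
    rw [lintegral_withDensity_rpow hvm hG]
    refine lintegral_mono_ae ?_
    filter_upwards [hgt] with x hx
    calc G x ^ q * (Hf x * Hg x ^ (1 - q)) ≤ Hg x ^ q * (Hf x * Hg x ^ (1 - q)) := by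
          gcongr; exact hgG x
      _ = (Hg x ^ q * Hg x ^ (1 - q)) * Hf x := by ring
      _ = Hg x * Hf x := by
          rw [← ENNReal.rpow_add _ _ (hg0 x) hx]; simp
  have h1 : A ≤ ∫⁻ x, (F x ^ q * v x) ^ (1 / q) * (Hg x * Hf x) ^ (1 - 1 / q) := by
    rw [hAdef, lintegral_withDensity_rpow hwm hF]
    refine lintegral_mono_ae ?_
    filter_upwards [hgt, hft, hf0, hFt] with x hx hfx hfx0 hFx
    have e1 : F x ^ p * w x = F x * φ x := by
      simp only [hφ]
      rw [← mul_assoc]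
      conv_rhs => rw [← ENNReal.rpow_one (F x), ← ENNReal.rpow_mul]
      rw [← ENNReal.rpow_add _ _ (hF0 x) hFx]
      congr 2; ring
    have hr : 0 ≤ 1 / q := by positivity
    have hr' : 0 ≤ 1 - 1 / q := by
      rw [sub_nonneg, div_le_one hq0]; exact hq.le
    have e2 : (F x ^ q * v x) ^ (1 / q) * (Hg x * Hf x) ^ (1 - 1 / q) = F x * Hf x := by
      simp only [hv]
      rw [ENNReal.mul_rpow_of_nonneg _ _ hr, ENNReal.mul_rpow_of_nonneg _ _ hr,
        ENNReal.mul_rpow_of_nonneg _ _ hr', ← ENNReal.rpow_mul, ← ENNReal.rpow_mul,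
        mul_one_div_cancel hq0.ne', ENNReal.rpow_one]
      calc _ = F x * (Hf x ^ (1 / q) * Hf x ^ (1 - 1 / q)) *
            (Hg x ^ ((1 - q) * (1 / q)) * Hg x ^ (1 - 1 / q)) := by ring
        _ = F x * Hf x := by
          rw [← ENNReal.rpow_add _ _ (hg0 x) hx, ← ENNReal.rpow_add _ _ hfx0 hfx]
          have : (1 - q) * (1 / q) + (1 - 1 / q) = 0 := by field_simp; ring
          rw [this]; simp
    rw [e1, e2]
    gcongr
    exact hfφ x
  have h2 : A ≤ (D : ℝ≥0∞) ^ (1 / q) * X := by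
    refine h1.trans ((ENNReal.lintegral_mul_norm_pow_le (((hF.pow_const q).mul hvm).aemeasurable)
      (hgm.mul hfm).aemeasurable (by positivity)
      (by rw [sub_nonneg, div_le_one hq0]; exact hq.le) (by ring)).trans ?_)
    calc (∫⁻ x, F x ^ q * v x) ^ (1 / q) * X ^ (1 - 1 / q)
        ≤ (D * X) ^ (1 / q) * X ^ (1 - 1 / q) := by
          rw [← lintegral_withDensity_rpow hvm hF]
          gcongr
          exact (h v hvA).trans (mul_le_mul_right hGX _)
      _ = (D : ℝ≥0∞) ^ (1 / q) * X := by
          rw [ENNReal.mul_rpow_of_nonneg _ _ (by positivity), mul_assoc,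
            ← ENNReal.rpow_add_of_nonneg _ _ (by positivity)
              (by rw [sub_nonneg, div_le_one hq0]; exact hq.le)]
          simp
  have hXle : X ≤ (2 * B ^ (1 / p)) * (2 * A ^ (1 / (p / (p - 1)))) := by
    have hpq : p.HolderConjugate (p / (p - 1)) := Real.HolderConjugate.conjExponent hp
    calc X = ∫⁻ x, ((fun x => Hg x * w x ^ (1 / p)) * fun x => Hf x * w x ^ (-(1 / p))) x := by
          refine lintegral_congr_ae ?_
          filter_upwards [hw.ne_zero, hw.ne_top] with x h0 h1
          simp only [Pi.mul_apply]
          calc Hg x * Hf x = Hg x * Hf x * (w x ^ (1 / p) * w x ^ (-(1 / p))) := by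
                rw [← ENNReal.rpow_add _ _ h0 h1]; simp
            _ = _ := by ring
      _ ≤ _ := ENNReal.lintegral_mul_le_Lp_mul_Lq volume hpq
          (hgm.mul (hwm.pow_const _)).aemeasurable (hfm.mul (hwm.pow_const _)).aemeasurable
      _ ≤ _ := by
          refine mul_le_mul' (le_trans (le_of_eq ?_) hgn') (le_trans (le_of_eq ?_) hfn')
          · rw [lintegral_withDensity_rpow hwm hgm]
            congr 2; ext x
            rw [ENNReal.mul_rpow_of_nonneg _ _ hp0.le, ← ENNReal.rpow_mul,
              one_div_mul_cancel hp0.ne', ENNReal.rpow_one]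
          · rw [lintegral_withDensity_rpow (measurable_dualWeight hwm) hfm]
            congr 2; ext x
            rw [ENNReal.mul_rpow_of_nonneg _ _ hp'0.le, ← ENNReal.rpow_mul, dualWeight]
            congr 2; field_simp
  have h3 : A ^ (1 / p) ≤ 4 * (D : ℝ≥0∞) ^ (1 / q) * B ^ (1 / p) := by
    have e : A = A ^ (1 / p) * A ^ (1 / (p / (p - 1))) := by
      rw [← ENNReal.rpow_add _ _ hA0 hA]
      have : 1 / p + 1 / (p / (p - 1)) = 1 := by field_simp; ring
      rw [this, ENNReal.rpow_one]
    have h4 := h2.trans (mul_le_mul_right hXle _)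
    have hne : A ^ (1 / (p / (p - 1))) ≠ 0 :=
      (ENNReal.rpow_pos (pos_iff_ne_zero.2 hA0) hA).ne'
    -- Cancelling `A ^ (1 / p')` is where `A` must be nonzero and finite.
    refine (ENNReal.mul_le_mul_iff_left hne
      (ENNReal.rpow_ne_top_of_ne_zero hA0 hA)).1 ?_
    calc _ = A := e.symm
      _ ≤ _ := h4
      _ = _ := by ring
  have h5 := ENNReal.rpow_le_rpow h3 hp0.le
  rw [ENNReal.mul_rpow_of_nonneg _ _ hp0.le, ← ENNReal.rpow_mul, ← ENNReal.rpow_mul,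
    one_div_mul_cancel hp0.ne', ENNReal.rpow_one, ENNReal.rpow_one] at h5
  refine h5.trans (le_of_eq ?_)
  rw [ENNReal.coe_rpow_of_nonneg _ hp0.le, ENNReal.coe_mul,
    ENNReal.coe_rpow_of_nonneg _ (by positivity : 0 ≤ 1 / q)]
  rfl

/-- **Extrapolation of Rubio de Francia.** -/
theorem exists_isDominated_of_exponent {q : ℝ} (hq : 1 < q) (C : ℝ≥0 → ℝ≥0) :
    ∃ C' : ℝ → ℝ≥0 → ℝ≥0, ∀ F G : ℝ → ℝ≥0∞, Measurable F → Measurable G →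
      (∀ K w, IsAp q K w → ∫⁻ x, F x ^ q ∂(volume.withDensity w)
        ≤ C K * ∫⁻ x, G x ^ q ∂(volume.withDensity w)) → IsDominated C' F G := by
  refine ⟨fun p K => (4 * (C (extrapApConst q p K) + 1) ^ (1 / q)) ^ p,
    fun F G hF hG h p hp K w hw => ?_⟩
  have hp0 : 0 < p := by linarith
  have hq0 : 0 < q := by linarith
  set c : ℝ≥0 := (4 * (C (extrapApConst q p K) + 1) ^ (1 / q)) ^ p with hc
  have : SigmaFinite (volume.withDensity w) := SigmaFinite.withDensity_of_ne_top hw.ne_top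
  set ν := volume.withDensity w with hν
  suffices hmain : ∀ ε : ℝ≥0, 0 < ε → ∫⁻ x, F x ^ p ∂ν ≤ c * (∫⁻ x, G x ^ p ∂ν + ε) by
    by_cases hc0 : c = 0
    · have := hmain 1 one_pos
      rw [hc0, ENNReal.coe_zero, zero_mul] at this
      exact this.trans zero_le
    refine ENNReal.le_of_forall_pos_le_add fun ε hε _ => ?_
    refine (hmain (ε / c) (div_pos hε (pos_iff_ne_zero.2 hc0))).trans (le_of_eq ?_)
    rw [mul_add, ← ENNReal.coe_mul, mul_div_cancel₀ _ hc0]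
  intro ε hε
  -- A strictly positive function `e` with ∫e^p dν < ε removes zeros and infinite integrals: G
  -- becomes max(G, e) and F becomes max(min(F, n·e), e).
  obtain ⟨δ, hδ0, hδm, hδε⟩ := exists_pos_lintegral_lt_of_sigmaFinite ν
    (ENNReal.coe_ne_zero.2 hε.ne')
  set e : ℝ → ℝ≥0∞ := fun x => (δ x : ℝ≥0∞) ^ (1 / p) with he
  have hem : Measurable e := (hδm.coe_nnreal_ennreal).pow_const _
  have hep : ∀ x, e x ^ p = δ x := fun x => by
    rw [he, ← ENNReal.rpow_mul, one_div_mul_cancel hp0.ne', ENNReal.rpow_one]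
  have he0 : ∀ x, e x ≠ 0 := fun x =>
    (ENNReal.rpow_pos (by exact_mod_cast hδ0 x) ENNReal.coe_ne_top).ne'
  have heint : ∫⁻ x, e x ^ p ∂ν ≤ ε := by simp_rw [hep]; exact hδε.le
  have max_rpow_le : ∀ {s : ℝ} (a b : ℝ≥0∞), 0 < s → max a b ^ s ≤ a ^ s + b ^ s := by
    intro s a b hs
    rcases le_total a b with hab | hab
    · rw [max_eq_right hab]; exact le_add_self
    · rw [max_eq_left hab]; exact le_self_add
  have hG' : Measurable fun x => max (G x) (e x) := hG.max hem
  have htrunc : ∀ n : ℕ, ∫⁻ x, min (F x) (n * e x) ^ p ∂ν ≤ c * (∫⁻ x, G x ^ p ∂ν + ε) := by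
    intro n
    have hF' : Measurable fun x => max (min (F x) (n * e x)) (e x) :=
      (hF.min (hem.const_mul _)).max hem
    calc ∫⁻ x, min (F x) (n * e x) ^ p ∂ν ≤ ∫⁻ x, max (min (F x) (n * e x)) (e x) ^ p ∂ν :=
          lintegral_mono fun x => ENNReal.rpow_le_rpow (le_max_left _ _) hp0.le
      _ ≤ c * ∫⁻ x, max (G x) (e x) ^ p ∂ν := by
          -- The `+ 1` pays for the extra ∫e^q dv, which is at most ∫max(G, e)^q dv.
          refine extrapolation_of_pos (D := C (extrapApConst q p K) + 1) hq hp
            (by positivity) hw hF' hG'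
            (fun x => (lt_max_of_lt_right (pos_iff_ne_zero.2 (he0 x))).ne')
            (fun x => (lt_max_of_lt_right (pos_iff_ne_zero.2 (he0 x))).ne') ?_ fun v hv => ?_
          · refine ne_top_of_le_ne_top (b := ((n : ℝ≥0∞) ^ p + 1) * ε) (by finiteness) ?_
            refine le_trans ?_ (mul_le_mul_right heint _)
            rw [← lintegral_const_mul' _ _ (by finiteness)]
            refine lintegral_mono fun x => (max_rpow_le _ _ hp0).trans ?_
            rw [add_mul, one_mul, ← ENNReal.mul_rpow_of_nonneg _ _ hp0.le]
            gcongr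
            exact min_le_right _ _
          · calc ∫⁻ x, max (min (F x) (n * e x)) (e x) ^ q ∂(volume.withDensity v)
                ≤ ∫⁻ x, (F x ^ q + e x ^ q) ∂(volume.withDensity v) := by
                  refine lintegral_mono fun x => (max_rpow_le _ _ hq0).trans ?_
                  gcongr
                  exact min_le_left _ _
              _ = ∫⁻ x, F x ^ q ∂(volume.withDensity v) + ∫⁻ x, e x ^ q ∂(volume.withDensity v) :=
                  lintegral_add_left (hF.pow_const _) _
              _ ≤ C (extrapApConst q p K) * ∫⁻ x, max (G x) (e x) ^ q ∂(volume.withDensity v)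
                  + ∫⁻ x, max (G x) (e x) ^ q ∂(volume.withDensity v) := by
                  refine add_le_add ((h _ v hv).trans ?_) ?_
                  · gcongr; exact le_max_left _ _
                  · gcongr; exact le_max_right _ _
              _ = _ := by push_cast; ring
      _ ≤ c * (∫⁻ x, G x ^ p ∂ν + ε) := by
          gcongr
          refine le_trans ?_ (add_le_add_right heint _)
          rw [← lintegral_add_left (hG.pow_const _)]
          exact lintegral_mono fun x => max_rpow_le _ _ hp0
  -- As `e` vanishes nowhere, n·e increases to ∞ and the truncations increase to `F`.
  have hsup : ∀ x, F x ^ p = ⨆ n : ℕ, min (F x) (n * e x) ^ p := by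
    intro x
    rw [← ENNReal.iSup_rpow_of_pos hp0, ← inf_iSup_eq, ← ENNReal.iSup_mul, ENNReal.iSup_natCast,
      ENNReal.top_mul (he0 x), inf_top_eq]
  simp_rw [hsup]
  rw [lintegral_iSup]
  · exact iSup_le htrunc
  · exact fun n => (hF.min (hem.const_mul _)).pow_const _
  · intro m n hmn x
    dsimp only
    gcongr

theorem isAp_one {p : ℝ} (hp : 1 < p) : IsAp p 1 (fun _ => 1) where
  measurable := measurable_const
  ne_zero := by simp
  ne_top := by simp
  bound i := by
    have h1 : ratAvg volume i (fun _ => 1) ≤ 1 := by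
      rw [ratAvg, setLIntegral_one]; exact ENNReal.inv_mul_le_one _
    have h2 : dualWeight p (fun _ => 1) = fun _ => 1 := by ext x; simp [dualWeight]
    rw [h2]
    exact mul_le_one' h1 (ENNReal.rpow_le_one h1 (by linarith))

/-! ### Lattice norms for which the maximal operator is bounded. -/

theorem measurable_maxFn_prod {κ : Type*} [MeasurableSpace κ] {F : ℝ → κ → ℝ≥0∞}
    (hF : Measurable (Function.uncurry F)) :
    Measurable fun z : ℝ × κ => maxFn volume (fun s => F s z.2) z.1 := by
  refine Measurable.iSup fun i => ?_
  have h : Measurable fun k => ratAvg volume i (fun s => F s k) :=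
    (Measurable.lintegral_prod_left hF).const_mul _
  have : (fun z : ℝ × κ => (ratIcc i).indicator (fun _ => ratAvg volume i fun s => F s z.2) z.1)
      = (Prod.fst ⁻¹' ratIcc i).indicator fun z => ratAvg volume i fun s => F s z.2 := by
    ext z; by_cases hz : z.1 ∈ ratIcc i <;> simp [hz]
  rw [this]
  exact (h.comp measurable_snd).indicator (measurable_fst (measurableSet_ratIcc i))

/-- A countably subadditive lattice norm `N` on `[0, ∞]`-valued functions for which the maximal
operator, acting on functions with values in the lattice, satisfies weighted norm
inequalities. -/
structure IsMaxNorm {κ : Type} [MeasurableSpace κ] (N : (κ → ℝ≥0∞) → ℝ≥0∞) : Prop where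
  mono : ∀ f g : κ → ℝ≥0∞, (∀ k, f k ≤ g k) → N f ≤ N g
  const_mul : ∀ c : ℝ≥0, ∀ f : κ → ℝ≥0∞, N (fun k => c * f k) = c * N f
  tsum_le : ∀ f : ℕ → κ → ℝ≥0∞, (∀ l, Measurable (f l)) →
    N (fun k => ∑' l, f l k) ≤ ∑' l, N (f l)
  measurable : ∀ {β : Type} [MeasurableSpace β] (F : β → κ → ℝ≥0∞),
    Measurable (Function.uncurry F) → Measurable fun b => N (F b)
  dominated : ∃ C, ∀ F : ℝ → κ → ℝ≥0∞, Measurable (Function.uncurry F) →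
    IsDominated C (fun x => N fun k => maxFn volume (fun s => F s k) x) (fun x => N (F x))

theorem isMaxNorm_unit : IsMaxNorm (fun f : Unit → ℝ≥0∞ => f ()) where
  mono _ _ h := h ()
  const_mul _ _ := rfl
  tsum_le _ _ := le_rfl
  measurable _ hF := hF.comp (measurable_id.prodMk measurable_const)
  dominated := ⟨muckConst, fun _ hF _ hp _ _ hw => hw.lintegral_maxFn_rpow_le hp
    (hF.comp (measurable_id.prodMk measurable_const))⟩

theorem IsMaxNorm.powNorm {κ : Type} [MeasurableSpace κ] {N : (κ → ℝ≥0∞) → ℝ≥0∞}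
    (hN : IsMaxNorm N) {β : Type} [MeasurableSpace β] (ν : Measure β) [SFinite ν] {q : ℝ}
    (hq : 1 < q) :
    IsMaxNorm fun f : β × κ → ℝ≥0∞ => powNorm ν q fun b => N fun k => f (b, k) := by
  have hq0 : 0 < q := by linarith
  have hmeas : ∀ {β' : Type} [MeasurableSpace β'] (F : β' → β × κ → ℝ≥0∞),
      Measurable (Function.uncurry F) →
      Measurable fun z : β' × β => N fun k => F z.1 (z.2, k) := by
    intro β' _ F hF
    refine hN.measurable (fun z : β' × β => fun k => F z.1 (z.2, k)) ?_
    exact hF.comp (by fun_prop : Measurable fun z : (β' × β) × κ => (z.1.1, (z.1.2, z.2)))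
  refine ⟨fun f g h => powNorm_mono hq0.le fun b => hN.mono _ _ fun k => h (b, k),
    fun c f => ?_, fun f hf => ?_, fun F hF => ?_, ?_⟩
  · simp_rw [hN.const_mul]
    exact powNorm_const_mul hq0 ENNReal.coe_ne_top _
  · refine (powNorm_mono hq0.le fun b => hN.tsum_le (fun l k => f l (b, k)) fun l =>
      (hf l).comp (by fun_prop)).trans ?_
    exact powNorm_tsum_le hq.le fun l => hN.measurable (fun b k => f l (b, k)) (hf l)
  · exact (((hmeas F hF).pow_const q).lintegral_prod_right' (ν := ν)).pow_const _
  · obtain ⟨C, hC⟩ := hN.dominated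
    -- At the exponent `q` itself, Tonelli's theorem reduces the weighted inequality to that of `N`
    -- for each fixed `b`; extrapolation supplies the other exponents.
    obtain ⟨C', hC'⟩ := exists_isDominated_of_exponent hq (C q)
    refine ⟨C', fun F hF => ?_⟩
    have hMF : Measurable (Function.uncurry fun (x : ℝ) (z : β × κ) =>
        maxFn volume (fun s => F s z) x) := measurable_maxFn_prod hF
    refine hC' _ _ ?_ ?_ fun K w hw => ?_
    · exact (((hmeas _ hMF).pow_const q).lintegral_prod_right' (ν := ν)).pow_const _
    · exact (((hmeas F hF).pow_const q).lintegral_prod_right' (ν := ν)).pow_const _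
    · simp_rw [powNorm_rpow hq0]
      rw [lintegral_lintegral_swap
          (f := fun x b => N (fun k => maxFn volume (fun s => F s (b, k)) x) ^ q) ((hmeas _ hMF).pow_const q).aemeasurable,
        lintegral_lintegral_swap (f := fun x b => N (fun k => F x (b, k)) ^ q)
          ((hmeas F hF).pow_const q).aemeasurable,
        ← lintegral_const_mul' _ _ ENNReal.coe_ne_top]
      refine lintegral_mono fun b => hC (fun x k => F x (b, k)) ?_ q hq K w hw
      exact hF.comp (by fun_prop : Measurable fun z : ℝ × κ => (z.1, (b, z.2)))

/-! ### The strong maximal function. -/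

/-- The composition of the one-dimensional maximal operators in all the variables. -/
def strongMax : (n : ℕ) → ((Fin n → ℝ) → ℝ≥0∞) → (Fin n → ℝ) → ℝ≥0∞
  | 0, f => f
  | n + 1, f => fun x =>
      strongMax n (fun y => maxFn volume (fun s => f (Fin.cons s y)) (x 0)) (Fin.tail x)

theorem measurable_finCons {n : ℕ} :
    Measurable fun z : ℝ × (Fin n → ℝ) => (Fin.cons z.1 z.2 : Fin (n + 1) → ℝ) := by
  refine measurable_pi_iff.2 fun i => ?_
  refine Fin.cases ?_ (fun j => ?_) i
  · simpa using measurable_fst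
  · simp only [Fin.cons_succ]; fun_prop

theorem measurable_finTail {n : ℕ} :
    Measurable fun x : Fin (n + 1) → ℝ => (Fin.tail x : Fin n → ℝ) :=
  measurable_pi_iff.2 fun i => measurable_pi_apply i.succ

theorem measurable_strongMax {n : ℕ} {β : Type*} [MeasurableSpace β]
    {F : β → (Fin n → ℝ) → ℝ≥0∞} (hF : Measurable (Function.uncurry F)) :
    Measurable fun z : β × (Fin n → ℝ) => strongMax n (F z.1) z.2 := by
  induction n generalizing β with
  | zero => exact hF
  | succ n ih =>
    have h1 : Measurable (Function.uncurry fun (z : β × ℝ) (y : Fin n → ℝ) =>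
        maxFn volume (fun s => F z.1 (Fin.cons s y)) z.2) := by
      have : Measurable (Function.uncurry fun (s : ℝ) (z : β × (Fin n → ℝ)) =>
          F z.1 (Fin.cons s z.2)) :=
        hF.comp ((by fun_prop : Measurable fun z : ℝ × β × (Fin n → ℝ) => z.2.1).prodMk
          (measurable_finCons.comp
            (by fun_prop : Measurable fun z : ℝ × β × (Fin n → ℝ) => (z.1, z.2.2))))
      exact (measurable_maxFn_prod this).comp
        (by fun_prop : Measurable fun z : (β × ℝ) × (Fin n → ℝ) => (z.1.2, (z.1.1, z.2)))
    exact (ih h1).comp ((by fun_prop : Measurable fun z : β × (Fin (n + 1) → ℝ) =>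
      (z.1, z.2 0)).prodMk (measurable_finTail.comp measurable_snd))

theorem strongMax_mono {n : ℕ} {f g : (Fin n → ℝ) → ℝ≥0∞} (h : ∀ x, f x ≤ g x) (x : Fin n → ℝ) :
    strongMax n f x ≤ strongMax n g x := by
  induction n with
  | zero => exact h x
  | succ n ih => exact ih (fun y => maxFn_mono (fun s => h _) _) _

theorem lintegral_pi_finCons {n : ℕ} (I : Fin (n + 1) → Set ℝ) (hI : ∀ i, MeasurableSet (I i))
    {f : (Fin (n + 1) → ℝ) → ℝ≥0∞} (hf : Measurable f) :
    ∫⁻ x in Set.univ.pi I, f x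
      = ∫⁻ y in Set.univ.pi (Fin.tail I), ∫⁻ s in I 0, f (Fin.cons s y) := by
  have hmp := (volume_preserving_piFinSuccAbove (fun _ : Fin (n + 1) => ℝ) 0).symm
  have hpre : (MeasurableEquiv.piFinSuccAbove (fun _ : Fin (n + 1) => ℝ) 0).symm ⁻¹'
      (Set.univ.pi I) = I 0 ×ˢ Set.univ.pi (Fin.tail I) := by
    ext z
    simp [MeasurableEquiv.piFinSuccAbove, Fin.forall_fin_succ, Fin.tail]
  rw [← hmp.setLIntegral_comp_preimage (MeasurableSet.univ_pi hI) hf, hpre]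
  rw [Measure.volume_eq_prod, ← Measure.prod_restrict, lintegral_prod_symm]
  · simp [MeasurableEquiv.piFinSuccAbove, Fin.consEquiv]
  · exact (hf.comp hmp.measurable).aemeasurable

/-- By Tonelli the average over a box is an iterated average, and each one-dimensional average is at
most the maximal function in that variable. -/
theorem average_box_le_strongMax {n : ℕ} (i : Fin n → ℚ × ℚ) {f : (Fin n → ℝ) → ℝ≥0∞}
    (hf : Measurable f) {x : Fin n → ℝ} (hx : ∀ j, x j ∈ ratIcc (i j)) :
    (∏ j, volume (ratIcc (i j)))⁻¹ * ∫⁻ y in Set.univ.pi fun j => ratIcc (i j), f y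
      ≤ strongMax n f x := by
  induction n with
  | zero =>
    simp only [Finset.univ_eq_empty, Finset.prod_empty, inv_one, one_mul, strongMax]
    rw [Measure.volume_pi_eq_dirac x, show (Set.univ.pi fun j : Fin 0 => ratIcc (i j)) = Set.univ by
      ext y; simp, Measure.restrict_univ, lintegral_dirac' _ hf]
  | succ n ih =>
    have hm : Measurable fun y : Fin n → ℝ => ∫⁻ s in ratIcc (i 0), f (Fin.cons s y) :=
      Measurable.lintegral_prod_left (f := fun (s : ℝ) (y : Fin n → ℝ) => f (Fin.cons s y))
        (hf.comp measurable_finCons)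
    rw [lintegral_pi_finCons _ (fun j => measurableSet_ratIcc _) hf, Fin.prod_univ_succ,
      ENNReal.mul_inv (Or.inr (ENNReal.prod_ne_top fun j _ => volume_ratIcc_ne_top _))
        (Or.inl (volume_ratIcc_ne_top _)), mul_comm (volume (ratIcc (i 0)))⁻¹, mul_assoc,
      ← lintegral_const_mul _ hm]
    refine (ih (fun j => i j.succ) (f := fun y => ratAvg volume (i 0) fun s => f (Fin.cons s y))
      (hm.const_mul _) (x := Fin.tail x) fun j => hx j.succ).trans ?_
    exact strongMax_mono (fun y => ratAvg_le_maxFn (hx 0) _) _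

theorem eLpNorm_eq_powNorm {α : Type*} [MeasurableSpace α] {ν : Measure α} {p : ℝ≥0∞}
    (hp : 1 < p) (hpt : p < ∞) (f : α → ℝ≥0∞) : eLpNorm f p ν = powNorm ν p.toReal f := by
  rw [eLpNorm_eq_lintegral_rpow_enorm_toReal (by rintro rfl; simp at hp) hpt.ne]
  rfl

theorem one_lt_toReal {p : ℝ≥0∞} (hp : 1 < p) (hpt : p < ∞) : 1 < p.toReal := by
  have := (ENNReal.toReal_lt_toReal ENNReal.one_ne_top hpt.ne).2 hp
  simpa using this

/-! ### Mixed Lebesgue norms and the strong maximal function. -/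

section IteratedNorm

variable {n : ℕ} {p : Fin n → ℝ≥0∞}

theorem iteratedLpNorm_mono (hp : ∀ i, 1 < p i ∧ p i < ∞) {f g : (Fin n → ℝ) → ℝ≥0∞}
    (h : ∀ x, f x ≤ g x) : iteratedLpNorm n p f ≤ iteratedLpNorm n p g := by
  induction n with
  | zero => exact h _
  | succ n ih =>
    refine ih (fun i => hp i.succ) fun y => ?_
    rw [eLpNorm_eq_powNorm (hp 0).1 (hp 0).2, eLpNorm_eq_powNorm (hp 0).1 (hp 0).2]
    exact powNorm_mono ENNReal.toReal_nonneg fun s => h _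

theorem iteratedLpNorm_const_mul (hp : ∀ i, 1 < p i ∧ p i < ∞) {c : ℝ≥0∞} (hc : c ≠ ∞)
    (f : (Fin n → ℝ) → ℝ≥0∞) :
    iteratedLpNorm n p (fun x => c * f x) = c * iteratedLpNorm n p f := by
  induction n with
  | zero => rfl
  | succ n ih =>
    have h1 := one_lt_toReal (hp 0).1 (hp 0).2
    simp only [iteratedLpNorm]
    rw [← ih (p := Fin.tail p) (fun i => hp i.succ)]
    congr 1; ext y
    rw [eLpNorm_eq_powNorm (hp 0).1 (hp 0).2, eLpNorm_eq_powNorm (hp 0).1 (hp 0).2,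
      powNorm_const_mul (by linarith) hc]

theorem measurable_eLpNorm_finCons {q : ℝ≥0∞} (hq : 1 < q) (hqt : q < ∞)
    {f : (Fin (n + 1) → ℝ) → ℝ≥0∞} (hf : Measurable f) :
    Measurable fun y : Fin n → ℝ => eLpNorm (fun s : ℝ => f (Fin.cons s y)) q volume := by
  simp_rw [eLpNorm_eq_powNorm hq hqt]
  exact (Measurable.lintegral_prod_left
    (f := fun (s : ℝ) (y : Fin n → ℝ) => f (Fin.cons s y) ^ q.toReal)
    ((hf.comp measurable_finCons).pow_const _)).pow_const _

theorem iteratedLpNorm_tsum_le (hp : ∀ i, 1 < p i ∧ p i < ∞) {f : ℕ → (Fin n → ℝ) → ℝ≥0∞}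
    (hf : ∀ l, Measurable (f l)) :
    iteratedLpNorm n p (fun x => ∑' l, f l x) ≤ ∑' l, iteratedLpNorm n p (f l) := by
  induction n with
  | zero => exact le_rfl
  | succ n ih =>
    refine (iteratedLpNorm_mono (fun i => hp i.succ) fun y => ?_).trans
      (ih (fun i => hp i.succ) fun l => measurable_eLpNorm_finCons (hp 0).1 (hp 0).2 (hf l))
    have h1 := one_lt_toReal (hp 0).1 (hp 0).2
    simp_rw [eLpNorm_eq_powNorm (hp 0).1 (hp 0).2]
    exact powNorm_tsum_le h1.le fun l =>
      (hf l).comp (measurable_finCons.comp (measurable_id.prodMk measurable_const))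

/-- Tonelli makes almost every slice agree almost everywhere; for n = 0 Lebesgue measure is a Dirac
mass. It serves to replace almost everywhere measurable functions by measurable ones. -/
theorem iteratedLpNorm_congr_ae {f g : (Fin n → ℝ) → ℝ≥0∞} (h : f =ᵐ[volume] g) :
    iteratedLpNorm n p f = iteratedLpNorm n p g := by
  induction n with
  | zero =>
    rw [Measure.volume_pi_eq_dirac (Fin.elim0 : Fin 0 → ℝ)] at h
    have : MeasurableSingletonClass (Fin 0 → ℝ) := Pi.instMeasurableSingletonClass
    rw [Filter.EventuallyEq, ae_dirac_eq] at h
    exact h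
  | succ n ih =>
    refine ih ?_
    have hmp := (volume_preserving_piFinSuccAbove (fun _ : Fin (n + 1) => ℝ) 0).symm
    have h1 : ∀ᵐ z : ℝ × (Fin n → ℝ), f (Fin.cons z.1 z.2) = g (Fin.cons z.1 z.2) := by
      have := hmp.quasiMeasurePreserving.ae h
      simpa [MeasurableEquiv.piFinSuccAbove, Fin.consEquiv] using this
    have h2 : ∀ᵐ z : (Fin n → ℝ) × ℝ, f (Fin.cons z.2 z.1) = g (Fin.cons z.2 z.1) :=
      Measure.measurePreserving_swap.quasiMeasurePreserving.ae h1
    filter_upwards [Measure.ae_ae_of_ae_prod h2] with y hy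
    exact eLpNorm_congr_ae hy

/-- The lattice is generalized in the induction. The first variable s is moved into it: L^{p_1}(ds;
N) is again an `IsMaxNorm`, so the induction hypothesis treats the remaining variables. The operator
in the first variable is then bounded by the inequality for `N` with the weight 1. -/
theorem exists_iteratedLpNorm_strongMax_le (hp : ∀ i, 1 < p i ∧ p i < ∞) {κ : Type}
    [MeasurableSpace κ] {N : (κ → ℝ≥0∞) → ℝ≥0∞} (hN : IsMaxNorm N) :
    ∃ C : ℝ≥0, ∀ F : (Fin n → ℝ) → κ → ℝ≥0∞, Measurable (Function.uncurry F) →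
      iteratedLpNorm n p (fun y => N fun k => strongMax n (fun z => F z k) y)
        ≤ C * iteratedLpNorm n p (fun y => N (F y)) := by
  induction n generalizing κ with
  | zero => exact ⟨1, fun F _ => by simp [iteratedLpNorm, strongMax]⟩
  | succ n ih =>
    have h1 := one_lt_toReal (hp 0).1 (hp 0).2
    have h0 : 0 < (p 0).toReal := by linarith
    obtain ⟨C₁, hC₁⟩ := ih (fun i => hp i.succ) (hN.powNorm (volume : Measure ℝ) h1)
    obtain ⟨C₂, hC₂⟩ := hN.dominated
    refine ⟨C₁ * C₂ (p 0).toReal 1 ^ (1 / (p 0).toReal), fun F hF => ?_⟩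
    have hcons : ∀ y : Fin n → ℝ, Measurable (Function.uncurry fun (s : ℝ) (k : κ) =>
        F (Fin.cons s y) k) := fun y =>
      hF.comp ((measurable_finCons.comp (measurable_fst.prodMk measurable_const)).prodMk
        measurable_snd)
    have hF' : Measurable (Function.uncurry fun (y : Fin n → ℝ) (z : ℝ × κ) =>
        maxFn volume (fun s => F (Fin.cons s y) z.2) z.1) := by
      have : Measurable (Function.uncurry fun (s : ℝ) (z : (Fin n → ℝ) × κ) =>
          F (Fin.cons s z.1) z.2) :=
        hF.comp ((measurable_finCons.comp
          (by fun_prop : Measurable fun z : ℝ × (Fin n → ℝ) × κ => (z.1, z.2.1))).prodMk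
          (by fun_prop))
      exact (measurable_maxFn_prod this).comp
        (by fun_prop : Measurable fun z : (Fin n → ℝ) × ℝ × κ => (z.2.1, (z.1, z.2.2)))
    calc iteratedLpNorm (n + 1) p (fun y => N fun k => strongMax (n + 1) (fun z => F z k) y)
        = iteratedLpNorm n (Fin.tail p) (fun y => powNorm volume (p 0).toReal fun s =>
            N fun k => strongMax n (fun y' => maxFn volume (fun s' => F (Fin.cons s' y') k) s) y) := by
          simp only [iteratedLpNorm]
          congr 1; ext y
          rw [eLpNorm_eq_powNorm (hp 0).1 (hp 0).2]
          simp only [strongMax, Fin.cons_zero, Fin.tail_cons]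
      _ ≤ C₁ * iteratedLpNorm n (Fin.tail p) (fun y => powNorm volume (p 0).toReal fun s =>
            N fun k => maxFn volume (fun s' => F (Fin.cons s' y) k) s) := hC₁ _ hF'
      _ ≤ C₁ * iteratedLpNorm n (Fin.tail p) (fun y =>
            (C₂ (p 0).toReal 1 ^ (1 / (p 0).toReal) : ℝ≥0) *
              eLpNorm (fun s => N (F (Fin.cons s y))) (p 0) volume) := by
          gcongr
          refine iteratedLpNorm_mono (fun i => hp i.succ) fun y => ?_
          rw [eLpNorm_eq_powNorm (hp 0).1 (hp 0).2, powNorm_le_iff h0,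
            ENNReal.mul_rpow_of_nonneg _ _ h0.le, powNorm_rpow h0,
            ENNReal.coe_rpow_of_nonneg _ (by positivity), ← ENNReal.rpow_mul,
            one_div_mul_cancel h0.ne', ENNReal.rpow_one]
          have := hC₂ _ (hcons y) (p 0).toReal h1 1 _ (isAp_one h1)
          have hv : (volume : Measure ℝ).withDensity (fun _ => 1) = volume := withDensity_one
          rwa [hv] at this
      _ = _ := by
          rw [iteratedLpNorm_const_mul (p := Fin.tail p) (fun i => hp i.succ) ENNReal.coe_ne_top, ENNReal.coe_mul,
            mul_assoc]
          rfl

end IteratedNorm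

/-! ### Pointwise control of the maximal function on a dyadic cube. -/

/-- The uncentred Hardy–Littlewood maximal function of a `[0, ∞]`-valued function. -/
def hlFn {n : ℕ} (g : EuclideanSpace ℝ (Fin n) → ℝ≥0∞) (x : EuclideanSpace ℝ (Fin n)) : ℝ≥0∞ :=
  ⨆ (c : EuclideanSpace ℝ (Fin n)) (R : ℝ) (_ : x ∈ Metric.ball c R),
    (volume (Metric.ball c R))⁻¹ * ∫⁻ y in Metric.ball c R, g y

section Cubes

variable {n : ℕ}

/-- The dyadic cube with side `2^{-j}` and corner `2^{-j} m`, in coordinates. -/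
def coordCube (j : ℤ) (m : Fin n → ℤ) : Set (Fin n → ℝ) :=
  Set.univ.pi fun i => Set.Ico ((2 : ℝ) ^ (-j) * (m i : ℝ)) ((2 : ℝ) ^ (-j) * ((m i : ℝ) + 1))

/-- The threefold dilate of a dyadic cube. -/
def tripleCube (j : ℤ) (m : Fin n → ℤ) : Set (Fin n → ℝ) :=
  Set.univ.pi fun i =>
    Set.Ico ((2 : ℝ) ^ (-j) * ((m i : ℝ) - 1)) ((2 : ℝ) ^ (-j) * ((m i : ℝ) + 2))

/-- The position of the ancestor, `l` generations above, of the dyadic cube at position `m`. -/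
def ancestor (l : ℕ) (m : Fin n → ℤ) : Fin n → ℤ := fun i => m i / 2 ^ l

/-- The side length `2^{-j}`. -/
def side (j : ℤ) : ℝ≥0∞ := ENNReal.ofReal ((2 : ℝ) ^ (-j))

theorem side_eq_rpow (j : ℤ) : side j = (2 : ℝ≥0∞) ^ (-(j : ℝ)) := by
  rw [side, ← Real.rpow_intCast, ← ENNReal.ofReal_rpow_of_pos (by norm_num), ENNReal.ofReal_ofNat]
  push_cast; rfl

theorem side_ne_zero (j : ℤ) : side j ≠ 0 := by
  rw [side]; simp only [ne_eq, ENNReal.ofReal_eq_zero, not_le]; positivity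

theorem side_ne_top (j : ℤ) : side j ≠ ∞ := ENNReal.ofReal_ne_top

theorem measurableSet_coordCube (j : ℤ) (m : Fin n → ℤ) : MeasurableSet (coordCube j m) :=
  MeasurableSet.univ_pi fun _ => measurableSet_Ico

theorem measurableSet_tripleCube (j : ℤ) (m : Fin n → ℤ) : MeasurableSet (tripleCube j m) :=
  MeasurableSet.univ_pi fun _ => measurableSet_Ico

theorem coordCube_subset_tripleCube (j : ℤ) (m : Fin n → ℤ) :
    coordCube j m ⊆ tripleCube j m := by
  refine Set.pi_mono fun i _ => Set.Ico_subset_Ico ?_ ?_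
  · gcongr; linarith
  · gcongr; linarith

theorem mem_coordCube_ancestor {j : ℤ} {m : Fin n → ℤ} {x : Fin n → ℝ} (hx : x ∈ coordCube j m)
    (l : ℕ) : x ∈ coordCube (j - l) (ancestor l m) := by
  intro i _
  obtain ⟨h1, h2⟩ := hx i trivial
  have hside : (2 : ℝ) ^ (-(j - (l : ℤ))) = 2 ^ (-j) * 2 ^ l := by
    rw [neg_sub, sub_eq_add_neg, add_comm, zpow_add₀ (by norm_num), zpow_natCast]
  have hpos : (0 : ℝ) < 2 ^ (-j) := by positivity
  -- Integer division by a positive number rounds down, for negative `m i` too, as dyadic ancestors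
  -- require.
  have hd1 : (m i / 2 ^ l) * 2 ^ l ≤ m i := Int.ediv_mul_le _ (by positivity)
  have hd2 : m i + 1 ≤ (m i / 2 ^ l + 1) * 2 ^ l :=
    Int.lt_ediv_add_one_mul_self (m i) (by positivity)
  have hd1' : ((m i / 2 ^ l : ℤ) : ℝ) * 2 ^ l ≤ m i := by exact_mod_cast hd1
  have hd2' : (m i : ℝ) + 1 ≤ (((m i / 2 ^ l : ℤ) : ℝ) + 1) * 2 ^ l := by exact_mod_cast hd2
  simp only [hside, ancestor]
  constructor
  · refine le_trans ?_ h1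
    rw [mul_assoc]; gcongr; linarith
  · refine h2.trans_le ?_
    rw [mul_assoc]; gcongr; linarith

theorem mem_tripleCube_of_abs_sub_le {j : ℤ} {m : Fin n → ℤ} {x y : Fin n → ℝ}
    (hx : x ∈ coordCube j m) (hxy : ∀ i, |y i - x i| < (2 : ℝ) ^ (-j)) : y ∈ tripleCube j m := by
  intro i _
  obtain ⟨h1, h2⟩ := hx i trivial
  have h := abs_lt.1 (hxy i)
  constructor <;> nlinarith

theorem tripleCube_subset_iUnion (j : ℤ) (m : Fin n → ℤ) {x : Fin n → ℝ}
    (hx : x ∈ tripleCube j m) :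
    ∃ e : Fin n → Fin 3, x ∈ coordCube j fun i => m i + ((e i : ℤ) - 1) := by
  have : ∀ i, ∃ e : Fin 3, x i ∈ Set.Ico ((2 : ℝ) ^ (-j) * ((m i + ((e : ℤ) - 1) : ℤ) : ℝ))
      ((2 : ℝ) ^ (-j) * (((m i + ((e : ℤ) - 1) : ℤ) : ℝ) + 1)) := by
    intro i
    obtain ⟨h1, h2⟩ := hx i trivial
    by_cases ha : x i < (2 : ℝ) ^ (-j) * (m i : ℝ)
    · refine ⟨0, ?_, ?_⟩
      · push_cast; simpa [sub_eq_add_neg] using h1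
      · push_cast; simpa using ha
    · by_cases hb : x i < (2 : ℝ) ^ (-j) * ((m i : ℝ) + 1)
      · refine ⟨1, ?_, ?_⟩
        · simpa using ha
        · simpa using hb
      · refine ⟨2, ?_, ?_⟩
        · norm_num; simpa using hb
        · norm_num; rw [add_assoc]; norm_num; simpa only [zpow_neg] using h2
  choose e he using this
  exact ⟨e, fun i _ => he i⟩

/-- Averages over cubes are controlled by the strong maximal function. -/
theorem setLIntegral_cube_le_strongMax {g : (Fin n → ℝ) → ℝ≥0∞} (hg : Measurable g)
    {a : Fin n → ℝ} {s : ℝ} (hs : 0 < s) {x : Fin n → ℝ}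
    (hx : ∀ i, x i ∈ Set.Icc (a i) (a i + s)) :
    ∫⁻ y in Set.univ.pi (fun i => Set.Icc (a i) (a i + s)), g y
      ≤ ENNReal.ofReal (2 * s) ^ n * strongMax n g x := by
  have h1 : ∀ i, ∃ q : ℚ × ℚ, (q.1 : ℝ) ≤ a i ∧ a i + s ≤ q.2 ∧ (q.2 : ℝ) - q.1 ≤ 2 * s := by
    -- Rational end points are chosen within s/2 outside each end, which gives the factor 2 per
    -- coordinate.
    intro i
    obtain ⟨q1, h1, h2⟩ := exists_rat_btwn (show a i - s / 2 < a i by linarith)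
    obtain ⟨q2, h3, h4⟩ := exists_rat_btwn (show a i + s < a i + s + s / 2 by linarith)
    exact ⟨(q1, q2), h2.le, h3.le, by simp only; linarith⟩
  choose q hq1 hq2 hq3 using h1
  have hsub : ∀ i, Set.Icc (a i) (a i + s) ⊆ ratIcc (q i) := fun i =>
    Set.Icc_subset_Icc (hq1 i) (hq2 i)
  have havg := average_box_le_strongMax q hg fun j => hsub j (hx j)
  have hvol : ∏ j, volume (ratIcc (q j)) ≤ ENNReal.ofReal (2 * s) ^ n := by
    calc ∏ j, volume (ratIcc (q j)) ≤ ∏ _j : Fin n, ENNReal.ofReal (2 * s) := by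
          refine Finset.prod_le_prod' fun j _ => ?_
          rw [ratIcc, Real.volume_Icc]
          exact ENNReal.ofReal_le_ofReal (hq3 j)
      _ = _ := by simp
  have hv0 : ∏ j, volume (ratIcc (q j)) ≠ 0 := by
    refine Finset.prod_ne_zero_iff.2 fun j _ => ?_
    rw [ratIcc, Real.volume_Icc]
    have := hq1 j; have := hq2 j
    simp only [ne_eq, ENNReal.ofReal_eq_zero, not_le]; linarith
  have hvt : ∏ j, volume (ratIcc (q j)) ≠ ∞ :=
    ENNReal.prod_ne_top fun j _ => volume_ratIcc_ne_top _
  calc ∫⁻ y in Set.univ.pi (fun i => Set.Icc (a i) (a i + s)), g y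
      ≤ ∫⁻ y in Set.univ.pi (fun i => ratIcc (q i)), g y :=
        lintegral_mono_set (Set.pi_mono fun i _ => hsub i)
    _ = (∏ j, volume (ratIcc (q j))) * ((∏ j, volume (ratIcc (q j)))⁻¹ *
          ∫⁻ y in Set.univ.pi (fun i => ratIcc (q i)), g y) := by
        rw [← mul_assoc, ENNReal.mul_inv_cancel hv0 hvt, one_mul]
    _ ≤ _ := mul_le_mul' hvol havg

/-- The normalised integral of `g` over the threefold dilate of a dyadic cube. -/
def tripleAvg (j : ℤ) (m : Fin n → ℤ) (g : (Fin n → ℝ) → ℝ≥0∞) : ℝ≥0∞ :=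
  (side j ^ n)⁻¹ * ∫⁻ y in tripleCube j m, g y

/-- The factor per coordinate is 6 = 2·3: 2 from rational end points, and 3 because the average is
normalized by the cube and not by its dilate. -/
theorem tripleAvg_le_strongMax {g : (Fin n → ℝ) → ℝ≥0∞} (hg : Measurable g) {j : ℤ}
    {m : Fin n → ℤ} {x : Fin n → ℝ} (hx : x ∈ tripleCube j m) :
    tripleAvg j m g ≤ 6 ^ n * strongMax n ((tripleCube j m).indicator g) x := by
  have hpos : (0 : ℝ) < 2 ^ (-j) := by positivity
  set a : Fin n → ℝ := fun i => (2 : ℝ) ^ (-j) * ((m i : ℝ) - 1) with ha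
  have hIcc : ∀ i, Set.Ico ((2 : ℝ) ^ (-j) * ((m i : ℝ) - 1)) ((2 : ℝ) ^ (-j) * ((m i : ℝ) + 2))
      ⊆ Set.Icc (a i) (a i + 3 * 2 ^ (-j)) := fun i y hy =>
    ⟨hy.1, by have := hy.2.le; simp only [ha]; linarith⟩
  have h := setLIntegral_cube_le_strongMax (hg.indicator (measurableSet_tripleCube j m))
    (a := a) (s := 3 * 2 ^ (-j)) (by positivity) fun i => hIcc i (hx i trivial)
  have h2 : ∫⁻ y in tripleCube j m, g y ≤
      ∫⁻ y in Set.univ.pi (fun i => Set.Icc (a i) (a i + 3 * 2 ^ (-j))),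
        (tripleCube j m).indicator g y := by
    rw [lintegral_indicator (measurableSet_tripleCube j m), Measure.restrict_restrict
      (measurableSet_tripleCube j m), (Set.inter_eq_left.2 (Set.pi_mono fun i _ => hIcc i) :
        tripleCube j m ∩ _ = tripleCube j m)]
  have h3 : ENNReal.ofReal (2 * (3 * 2 ^ (-j))) = 6 * side j := by
    rw [side, ← mul_assoc, ENNReal.ofReal_mul (by norm_num)]; norm_num
  rw [h3, mul_pow] at h
  calc tripleAvg j m g ≤ (side j ^ n)⁻¹ *
        (6 ^ n * side j ^ n * strongMax n ((tripleCube j m).indicator g) x) := by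
        rw [tripleAvg]; gcongr; exact h2.trans h
    _ = ((side j ^ n)⁻¹ * side j ^ n) * (6 ^ n * strongMax n ((tripleCube j m).indicator g) x) := by
        ring
    _ = _ := by
        rw [ENNReal.inv_mul_cancel (pow_ne_zero _ (side_ne_zero j))
          (ENNReal.pow_ne_top (side_ne_top j)), one_mul]

/-- The `l`-th term in the bound for the maximal function on a dyadic cube. -/
def pieceFn (j : ℤ) (m : Fin n → ℤ) (g : (Fin n → ℝ) → ℝ≥0∞) (l : ℕ) (x : Fin n → ℝ) : ℝ≥0∞ :=
  if l = 0 then strongMax n ((tripleCube j m).indicator g) x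
  else tripleAvg (j - l) (ancestor l m) g

theorem abs_sub_lt_of_mem_ball {x c : EuclideanSpace ℝ (Fin n)} {R : ℝ} (hx : x ∈ Metric.ball c R)
    (i : Fin n) : |x i - c i| < R := by
  rw [Metric.mem_ball, dist_eq_norm] at hx
  refine lt_of_le_of_lt ?_ hx
  simpa using PiLp.norm_apply_le (x - c) i

theorem hlFn_le_tsum_pieceFn (n : ℕ) : ∃ C : ℝ≥0, ∀ g : EuclideanSpace ℝ (Fin n) → ℝ≥0∞,
    Measurable g → ∀ (j : ℤ) (m : Fin n → ℤ) (x : Fin n → ℝ), x ∈ coordCube j m →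
      hlFn g (WithLp.toLp 2 x) ≤ C * ∑' l, pieceFn j m (fun y => g (WithLp.toLp 2 y)) l x := by
  set κ : ℝ≥0∞ := volume (Metric.ball (0 : EuclideanSpace ℝ (Fin n)) 1) with hκ
  have hκ0 : κ ≠ 0 := (Metric.measure_ball_pos _ _ one_pos).ne'
  have hκt : κ ≠ ∞ := measure_ball_lt_top.ne
  refine ⟨(κ⁻¹).toNNReal * 4 ^ n, fun g hg j m x hx => ?_⟩
  have hC : (((κ⁻¹).toNNReal * 4 ^ n : ℝ≥0) : ℝ≥0∞) = κ⁻¹ * 4 ^ n := by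
    rw [ENNReal.coe_mul, ENNReal.coe_toNNReal (ENNReal.inv_ne_top.2 hκ0)]; norm_num
  rw [hC]
  set g' : (Fin n → ℝ) → ℝ≥0∞ := fun y => g (WithLp.toLp 2 y) with hg'
  have hg'm : Measurable g' := hg.comp (PiLp.volume_preserving_toLp (Fin n)).measurable
  refine iSup_le fun c => iSup_le fun R => iSup_le fun hxR => ?_
  have hR : 0 < R := lt_of_le_of_lt dist_nonneg (Metric.mem_ball.1 hxR)
  have hball : volume (Metric.ball c R) = ENNReal.ofReal R ^ n * κ := by
    rw [Measure.addHaar_ball_of_pos _ _ hR, finrank_euclideanSpace_fin,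
      ENNReal.ofReal_pow hR.le]
  set B : Set (Fin n → ℝ) := {y | WithLp.toLp 2 y ∈ Metric.ball c R} with hB
  have hBm : MeasurableSet B :=
    (PiLp.volume_preserving_toLp (Fin n)).measurable measurableSet_ball
  have hint : ∫⁻ y in Metric.ball c R, g y = ∫⁻ y in B, g' y :=
    ((PiLp.volume_preserving_toLp (Fin n)).setLIntegral_comp_preimage measurableSet_ball hg).symm
  have hR0 : ENNReal.ofReal R ^ n ≠ 0 := pow_ne_zero _ (by simpa using hR)
  have hRt : ENNReal.ofReal R ^ n ≠ ∞ := ENNReal.pow_ne_top ENNReal.ofReal_ne_top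
  rw [hball, hint, ENNReal.mul_inv (Or.inl hR0) (Or.inl hRt), mul_comm _ κ⁻¹, mul_assoc, mul_assoc]
  gcongr κ⁻¹ * ?_
  have hex : ∃ l : ℕ, 2 * R ≤ 2 ^ l * (2 : ℝ) ^ (-j) := by
    obtain ⟨l, hl⟩ := pow_unbounded_of_one_lt (2 * R / (2 : ℝ) ^ (-j)) one_lt_two
    exact ⟨l, ((div_lt_iff₀ (by positivity)).1 hl).le⟩
  classical
  -- `l` is the first generation whose side is at least the diameter 2R. So the ball lies in the
  -- dilate of that ancestor, and if l ≠ 0 then minimality bounds the side by 4R.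
  set l := Nat.find hex with hl
  have hl1 : 2 * R ≤ 2 ^ l * (2 : ℝ) ^ (-j) := Nat.find_spec hex
  have hside : (2 : ℝ) ^ (-(j - (l : ℤ))) = 2 ^ l * 2 ^ (-j) := by
    rw [neg_sub, sub_eq_add_neg, zpow_add₀ (by norm_num), zpow_natCast]
  have hBsub : B ⊆ tripleCube (j - l) (ancestor l m) := by
    intro y hy
    refine mem_tripleCube_of_abs_sub_le (mem_coordCube_ancestor hx l) fun i => ?_
    have h1 := abs_sub_lt_of_mem_ball hy i
    have h2 := abs_sub_lt_of_mem_ball hxR i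
    rw [hside]
    have h3 : |y i - x i| ≤ |y i - c i| + |x i - c i| := by
      rw [abs_sub_comm (x i)]; exact abs_sub_le _ _ _
    simp only at h1 h2
    linarith
  refine le_trans ?_ (mul_le_mul_right (ENNReal.le_tsum l) _)
  by_cases hl0 : l = 0
  · rw [hl0] at hBsub ⊢
    have hB' : B ⊆ tripleCube j m := by
      refine hBsub.trans (le_of_eq ?_)
      have : ancestor 0 m = m := by ext i; simp [ancestor]
      rw [this]; simp
    rw [pieceFn, if_pos rfl]
    have h := setLIntegral_cube_le_strongMax (hg'm.indicator (measurableSet_tripleCube j m))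
      (a := fun i => c i - R) (s := 2 * R) (by positivity) (x := x) fun i => by
        have := abs_lt.1 (abs_sub_lt_of_mem_ball hxR i)
        simp only at this
        constructor <;> linarith
    have h2 : ∫⁻ y in B, g' y ≤ ∫⁻ y in Set.univ.pi (fun i => Set.Icc (c i - R) (c i - R + 2 * R)),
        (tripleCube j m).indicator g' y := by
      rw [← lintegral_indicator hBm, ← lintegral_indicator
        (MeasurableSet.univ_pi fun i => measurableSet_Icc)]
      refine lintegral_mono fun y => ?_
      by_cases hy : y ∈ B
      · have hy2 : y ∈ Set.univ.pi (fun i => Set.Icc (c i - R) (c i - R + 2 * R)) := by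
          intro i _
          have := abs_lt.1 (abs_sub_lt_of_mem_ball hy i)
          simp only at this
          constructor <;> linarith
        rw [Set.indicator_of_mem hy, Set.indicator_of_mem hy2, Set.indicator_of_mem (hB' hy)]
      · rw [Set.indicator_of_notMem hy]; exact zero_le
    have h3 : ENNReal.ofReal (2 * (2 * R)) ^ n = 4 ^ n * ENNReal.ofReal R ^ n := by
      rw [← mul_assoc, ENNReal.ofReal_mul (by norm_num), mul_pow]; norm_num
    rw [h3] at h
    calc (ENNReal.ofReal R ^ n)⁻¹ * ∫⁻ y in B, g' y
        ≤ (ENNReal.ofReal R ^ n)⁻¹ * (4 ^ n * ENNReal.ofReal R ^ n *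
            strongMax n ((tripleCube j m).indicator g') x) := by gcongr; exact h2.trans h
      _ = ((ENNReal.ofReal R ^ n)⁻¹ * ENNReal.ofReal R ^ n) *
            (4 ^ n * strongMax n ((tripleCube j m).indicator g') x) := by ring
      _ = _ := by rw [ENNReal.inv_mul_cancel hR0 hRt, one_mul]
  · rw [pieceFn, if_neg hl0, tripleAvg, ← mul_assoc]
    refine mul_le_mul' ?_ (lintegral_mono_set hBsub)
    have hlt : 2 ^ (l - 1) * (2 : ℝ) ^ (-j) < 2 * R :=
      not_le.1 (Nat.find_min hex (Nat.sub_lt (Nat.pos_of_ne_zero hl0) one_pos))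
    have h4 : side (j - l) ≤ 4 * ENNReal.ofReal R := by
      rw [side, hside, ← ENNReal.ofReal_ofNat 4, ← ENNReal.ofReal_mul (by norm_num)]
      refine ENNReal.ofReal_le_ofReal ?_
      obtain ⟨k, hk⟩ := Nat.exists_eq_succ_of_ne_zero hl0
      rw [hk] at hlt ⊢
      simp only [Nat.succ_eq_add_one, Nat.add_sub_cancel] at hlt
      rw [pow_succ]; linarith
    have h5 : side (j - l) ^ n ≤ 4 ^ n * ENNReal.ofReal R ^ n := by
      rw [← mul_pow]; gcongr
    rw [← div_eq_mul_inv, ENNReal.le_div_iff_mul_le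
      (Or.inl (pow_ne_zero _ (side_ne_zero _))) (Or.inl (ENNReal.pow_ne_top (side_ne_top _)))]
    calc (ENNReal.ofReal R ^ n)⁻¹ * side (j - l) ^ n
        ≤ (ENNReal.ofReal R ^ n)⁻¹ * (4 ^ n * ENNReal.ofReal R ^ n) := by gcongr
      _ = ((ENNReal.ofReal R ^ n)⁻¹ * ENNReal.ofReal R ^ n) * 4 ^ n := by ring
      _ = 4 ^ n := by rw [ENNReal.inv_mul_cancel hR0 hRt, one_mul]

end Cubes

/-! ### ℓ^r norms of sequences indexed by dyadic cubes. -/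

section Sequences

variable {ι : Type*} {r : ℝ≥0∞}

theorem ellNorm_eq_powNorm [MeasurableSpace ι] [DiscreteMeasurableSpace ι]
    (hr : r ≠ ∞) (a : ι → ℝ≥0∞) : ellNorm r a = powNorm Measure.count r.toReal a := by
  rw [ellNorm, if_neg hr, powNorm, lintegral_count]

theorem ellNorm_mono {a b : ι → ℝ≥0∞} (h : ∀ i, a i ≤ b i) : ellNorm r a ≤ ellNorm r b := by
  unfold ellNorm
  split_ifs
  · exact iSup_mono h
  · exact ENNReal.rpow_le_rpow (ENNReal.tsum_le_tsum fun i =>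
      ENNReal.rpow_le_rpow (h i) ENNReal.toReal_nonneg) (by positivity)

theorem ellNorm_const_mul (hr : 1 < r) (c : ℝ≥0∞) (a : ι → ℝ≥0∞) :
    ellNorm r (fun i => c * a i) = c * ellNorm r a := by
  unfold ellNorm
  split_ifs with h
  · rw [ENNReal.mul_iSup]
  · have h0 : 0 < r.toReal := by linarith [one_lt_toReal hr (lt_top_iff_ne_top.2 h)]
    simp_rw [ENNReal.mul_rpow_of_nonneg _ _ h0.le]
    rw [ENNReal.tsum_mul_left, ENNReal.mul_rpow_of_nonneg _ _ (by positivity), ← ENNReal.rpow_mul,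
      mul_one_div_cancel h0.ne', ENNReal.rpow_one]

theorem ellNorm_tsum_le (hr : 1 < r) (a : ℕ → ι → ℝ≥0∞) :
    ellNorm r (fun i => ∑' l, a l i) ≤ ∑' l, ellNorm r (a l) := by
  by_cases h : r = ∞
  · simp only [ellNorm, if_pos h]
    exact iSup_le fun i => ENNReal.tsum_le_tsum fun l => le_iSup (a l) i
  · let _ : MeasurableSpace ι := ⊤
    simp_rw [ellNorm_eq_powNorm h]
    exact powNorm_tsum_le (one_lt_toReal hr (lt_top_iff_ne_top.2 h)).le
      fun l => Measurable.of_discrete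

theorem ellNorm_add_le (hr : 1 < r) (a b : ι → ℝ≥0∞) :
    ellNorm r (a + b) ≤ ellNorm r a + ellNorm r b := by
  by_cases h : r = ∞
  · simp only [ellNorm, if_pos h]
    exact iSup_le fun i => add_le_add (le_iSup a i) (le_iSup b i)
  · let _ : MeasurableSpace ι := ⊤
    simp_rw [ellNorm_eq_powNorm h]
    exact powNorm_add_le (one_lt_toReal hr (lt_top_iff_ne_top.2 h)).le
      Measurable.of_discrete Measurable.of_discrete

theorem ellNorm_sum_le (hr : 1 < r) {ε : Type*} (s : Finset ε) (a : ε → ι → ℝ≥0∞) :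
    ellNorm r (∑ e ∈ s, a e) ≤ ∑ e ∈ s, ellNorm r (a e) := by
  refine Finset.le_sum_of_subadditive _ ?_ (ellNorm_add_le hr) s a
  have := ellNorm_const_mul hr 0 (0 : ι → ℝ≥0∞)
  simp only [zero_mul] at this
  exact this.le

theorem ellNorm_comp_equiv {ι' : Type*} (e : ι' ≃ ι) (a : ι → ℝ≥0∞) :
    ellNorm r (fun i => a (e i)) = ellNorm r a := by
  unfold ellNorm
  split_ifs
  · exact e.iSup_comp (g := a)
  · rw [e.tsum_eq fun i => a i ^ r.toReal]

/-- Division with remainder by 2^l in each coordinate shows that every position is the ancestor of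
exactly 2^{ln} positions. -/
theorem tsum_comp_ancestor {n : ℕ} (l : ℕ) (H : (Fin n → ℤ) → ℝ≥0∞) :
    ∑' m, H (ancestor l m) = (2 ^ l) ^ n * ∑' m, H m := by
  have : NeZero (2 ^ l) := ⟨by positivity⟩
  let e : (Fin n → ℤ) ≃ (Fin n → ℤ) × (Fin n → Fin (2 ^ l)) :=
    ((Equiv.refl (Fin n)).arrowCongr (Int.divModEquiv (2 ^ l))).trans
      (Equiv.arrowProdEquivProdArrow _ _ _)
  have he : ∀ m, (e m).1 = ancestor l m := by
    intro m
    ext i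
    simp [e, Int.divModEquiv, ancestor, Equiv.arrowProdEquivProdArrow]
  calc ∑' m, H (ancestor l m) = ∑' m, (fun z : (Fin n → ℤ) × (Fin n → Fin (2 ^ l)) => H z.1) (e m) :=
        by simp_rw [he]
    _ = ∑' z : (Fin n → ℤ) × (Fin n → Fin (2 ^ l)), H z.1 :=
        e.tsum_eq fun z : (Fin n → ℤ) × (Fin n → Fin (2 ^ l)) => H z.1
    _ = _ := by
      rw [ENNReal.tsum_prod (f := fun m _ => H m)]
      simp_rw [tsum_fintype, Finset.sum_const, nsmul_eq_mul]
      rw [ENNReal.tsum_mul_left]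
      simp

theorem ellNorm_comp_ancestor_le {n : ℕ} (hr : 1 < r) (l : ℕ) (c : ℤ × (Fin n → ℤ) → ℝ≥0∞) :
    ellNorm r (fun Q : ℤ × (Fin n → ℤ) => c (Q.1 - l, ancestor l Q.2))
      ≤ (2 : ℝ≥0∞) ^ ((l : ℝ) * n * (r⁻¹).toReal) * ellNorm r c := by
  unfold ellNorm
  split_ifs with h
  · subst h
    simp only [ENNReal.inv_top, ENNReal.toReal_zero, mul_zero, ENNReal.rpow_zero, one_mul]
    exact iSup_le fun Q => le_iSup c _
  · have h0 : 0 < r.toReal := by linarith [one_lt_toReal hr (lt_top_iff_ne_top.2 h)]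
    have e1 : ∑' Q : ℤ × (Fin n → ℤ), c (Q.1 - l, ancestor l Q.2) ^ r.toReal
        = (2 ^ l) ^ n * ∑' Q, c Q ^ r.toReal := by
      rw [ENNReal.tsum_prod (f := fun j m => c (j - l, ancestor l m) ^ r.toReal),
        ENNReal.tsum_prod (f := fun j m => c (j, m) ^ r.toReal), ← ENNReal.tsum_mul_left]
      have e2 : ∀ j : ℤ, ∑' m : Fin n → ℤ, c (j - l, ancestor l m) ^ r.toReal
          = (2 ^ l) ^ n * ∑' m : Fin n → ℤ, c (j - l, m) ^ r.toReal := fun j =>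
        tsum_comp_ancestor l fun m => c (j - l, m) ^ r.toReal
      simp_rw [e2]
      exact (Equiv.subRight (l : ℤ)).tsum_eq
        fun j => (2 ^ l) ^ n * ∑' m, c (j, m) ^ r.toReal
    rw [e1, ENNReal.mul_rpow_of_nonneg _ _ (by positivity)]
    refine mul_le_mul_left (le_of_eq ?_) _
    rw [← pow_mul, ← ENNReal.rpow_natCast, ← ENNReal.rpow_mul, ENNReal.toReal_inv]
    push_cast; rw [one_div]

end Sequences

/-! ### The local estimate on one dyadic cube. -/

section LocalEstimate

variable {n : ℕ} {p : Fin n → ℝ≥0∞}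

/-- Measurability of `f` allows `c = ∞`, which is needed since the lattice norm of an average may be
infinite. -/
theorem iteratedLpNorm_const_mul_of_measurable (hp : ∀ i, 1 < p i ∧ p i < ∞) (c : ℝ≥0∞)
    {f : (Fin n → ℝ) → ℝ≥0∞} (hf : Measurable f) :
    iteratedLpNorm n p (fun x => c * f x) = c * iteratedLpNorm n p f := by
  induction n with
  | zero => rfl
  | succ n ih =>
    have h1 := one_lt_toReal (hp 0).1 (hp 0).2
    have h0 : 0 < (p 0).toReal := by linarith
    simp only [iteratedLpNorm]
    rw [← ih (p := Fin.tail p) (fun i => hp i.succ)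
      (measurable_eLpNorm_finCons (hp 0).1 (hp 0).2 hf)]
    congr 1; ext y
    have hm : Measurable fun s : ℝ => f (Fin.cons s y) :=
      hf.comp (measurable_finCons.comp (measurable_id.prodMk measurable_const))
    rw [eLpNorm_eq_powNorm (hp 0).1 (hp 0).2, eLpNorm_eq_powNorm (hp 0).1 (hp 0).2]
    simp_rw [powNorm, ENNReal.mul_rpow_of_nonneg _ _ h0.le]
    rw [lintegral_const_mul _ (hm.pow_const _), ENNReal.mul_rpow_of_nonneg _ _ (by positivity),
      ← ENNReal.rpow_mul, mul_one_div_cancel h0.ne', ENNReal.rpow_one]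

theorem iteratedLpNorm_add_le (hp : ∀ i, 1 < p i ∧ p i < ∞) {f g : (Fin n → ℝ) → ℝ≥0∞}
    (hf : Measurable f) (hg : Measurable g) :
    iteratedLpNorm n p (f + g) ≤ iteratedLpNorm n p f + iteratedLpNorm n p g := by
  induction n with
  | zero => exact le_rfl
  | succ n ih =>
    refine (iteratedLpNorm_mono (p := Fin.tail p) (fun i => hp i.succ) fun y => ?_).trans
      (ih (p := Fin.tail p) (fun i => hp i.succ) (measurable_eLpNorm_finCons (hp 0).1 (hp 0).2 hf)
        (measurable_eLpNorm_finCons (hp 0).1 (hp 0).2 hg))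
    have h1 := one_lt_toReal (hp 0).1 (hp 0).2
    have hc : Measurable fun s : ℝ => (Fin.cons s y : Fin (n + 1) → ℝ) :=
      measurable_finCons.comp (measurable_id.prodMk measurable_const)
    simp only [Pi.add_apply]
    simp_rw [eLpNorm_eq_powNorm (hp 0).1 (hp 0).2]
    exact powNorm_add_le h1.le (hf.comp hc) (hg.comp hc)

theorem iteratedLpNorm_sum_le (hp : ∀ i, 1 < p i ∧ p i < ∞) {ε : Type*} (s : Finset ε)
    {f : ε → (Fin n → ℝ) → ℝ≥0∞} (hf : ∀ e, Measurable (f e)) :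
    iteratedLpNorm n p (∑ e ∈ s, f e) ≤ ∑ e ∈ s, iteratedLpNorm n p (f e) := by
  classical
  induction s using Finset.induction_on with
  | empty =>
    have := iteratedLpNorm_const_mul hp ENNReal.zero_ne_top (0 : (Fin n → ℝ) → ℝ≥0∞)
    simp only [zero_mul] at this
    rw [Finset.sum_empty, Finset.sum_empty]
    exact this.le
  | insert e s he ih =>
    rw [Finset.sum_insert he, Finset.sum_insert he]
    have hm : Measurable (∑ e ∈ s, f e) := by
      have := Finset.measurable_fun_sum s fun e _ => hf e
      convert this using 1; ext x; simp
    exact (iteratedLpNorm_add_le hp (hf e) hm).trans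
      (add_le_add_right ih _)

theorem iteratedLpNorm_indicator_pi (hp : ∀ i, 1 < p i ∧ p i < ∞) {I : Fin n → Set ℝ}
    (hI : ∀ i, MeasurableSet (I i)) {a : ℝ≥0∞} (ha0 : a ≠ 0) (hat : a ≠ ∞)
    (hv : ∀ i, volume (I i) = a) :
    iteratedLpNorm n p ((Set.univ.pi I).indicator fun _ => 1) = a ^ ∑ i, ((p i)⁻¹).toReal := by
  induction n with
  | zero => simp [iteratedLpNorm]
  | succ n ih =>
    have h1 := one_lt_toReal (hp 0).1 (hp 0).2
    have h0 : 0 < (p 0).toReal := by linarith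
    rw [Fin.sum_univ_succ, ENNReal.rpow_add _ _ ha0 hat,
      show (∑ i : Fin n, ((p i.succ)⁻¹).toReal) = ∑ i, ((Fin.tail p i)⁻¹).toReal from rfl,
      ← ih (p := Fin.tail p) (fun i => hp i.succ) (I := Fin.tail I) (fun i => hI i.succ)
        (fun i => hv i.succ),
      ← iteratedLpNorm_const_mul (p := Fin.tail p) (fun i => hp i.succ)
        (ENNReal.rpow_ne_top_of_nonneg ENNReal.toReal_nonneg hat)]
    simp only [iteratedLpNorm]
    congr 1; ext y
    rw [eLpNorm_eq_powNorm (hp 0).1 (hp 0).2]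
    have hmem : ∀ s : ℝ, (Fin.cons s y : Fin (n + 1) → ℝ) ∈ Set.univ.pi I ↔
        s ∈ I 0 ∧ y ∈ Set.univ.pi (Fin.tail I) := by
      intro s; simp [Fin.forall_fin_succ, Fin.tail]
    by_cases hy : y ∈ Set.univ.pi (Fin.tail I)
    · have : ∀ s, (Set.univ.pi I).indicator (fun _ => (1 : ℝ≥0∞)) (Fin.cons s y : Fin (n + 1) → ℝ)
          ^ (p 0).toReal = (I 0).indicator (fun _ => 1) s := by
        intro s
        by_cases hs : s ∈ I 0
        · rw [Set.indicator_of_mem ((hmem s).2 ⟨hs, hy⟩), Set.indicator_of_mem hs,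
            ENNReal.one_rpow]
        · rw [Set.indicator_of_notMem fun h => hs ((hmem s).1 h).1, Set.indicator_of_notMem hs,
            ENNReal.zero_rpow_of_pos h0]
      simp_rw [powNorm, this]
      rw [lintegral_indicator (hI 0), setLIntegral_one, hv, Set.indicator_of_mem hy, mul_one,
        ENNReal.toReal_inv, one_div]
    · have : ∀ s, (Set.univ.pi I).indicator (fun _ => (1 : ℝ≥0∞)) (Fin.cons s y : Fin (n + 1) → ℝ)
          ^ (p 0).toReal = 0 := by
        intro s
        rw [Set.indicator_of_notMem fun h => hy ((hmem s).1 h).2, ENNReal.zero_rpow_of_pos h0]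
      simp_rw [powNorm, this]
      rw [Set.indicator_of_notMem hy]
      simp [h0]

theorem iteratedLpNorm_indicator_coordCube (hp : ∀ i, 1 < p i ∧ p i < ∞) (j : ℤ)
    (m : Fin n → ℤ) :
    iteratedLpNorm n p ((coordCube j m).indicator fun _ => 1)
      = side j ^ ∑ i, ((p i)⁻¹).toReal := by
  refine iteratedLpNorm_indicator_pi hp (fun _ => measurableSet_Ico) (side_ne_zero j)
    (side_ne_top j) fun i => ?_
  rw [Real.volume_Ico, side]
  congr 1; ring

variable {κ : Type} [MeasurableSpace κ] {N : (κ → ℝ≥0∞) → ℝ≥0∞}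

theorem IsMaxNorm.map_indicator (hN : IsMaxNorm N) (S : Set (Fin n → ℝ))
    (G : (Fin n → ℝ) → κ → ℝ≥0∞) (x : Fin n → ℝ) :
    N (fun k => S.indicator (fun y => G y k) x) = S.indicator (fun y => N (G y)) x := by
  by_cases hx : x ∈ S
  · simp [hx]
  · have := hN.const_mul 0 (fun _ => 0)
    simpa [hx] using this

theorem measurable_strongMax_swap {F : (Fin n → ℝ) → κ → ℝ≥0∞}
    (hF : Measurable (Function.uncurry F)) :
    Measurable (Function.uncurry fun (x : Fin n → ℝ) k => strongMax n (fun y => F y k) x) :=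
  (measurable_strongMax (F := fun (k : κ) (y : Fin n → ℝ) => F y k)
    (hF.comp measurable_swap)).comp measurable_swap

theorem measurable_indicator_prod {S : Set (Fin n → ℝ)} (hS : MeasurableSet S)
    {G : (Fin n → ℝ) → κ → ℝ≥0∞} (hG : Measurable (Function.uncurry G)) :
    Measurable (Function.uncurry fun (x : Fin n → ℝ) k => S.indicator (fun y => G y k) x) := by
  have : (Function.uncurry fun (x : Fin n → ℝ) k => S.indicator (fun y => G y k) x)
      = (Prod.fst ⁻¹' S).indicator (Function.uncurry G) := by
    ext z; by_cases hz : z.1 ∈ S <;> simp [hz, Function.uncurry]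
  rw [this]
  exact hG.indicator (measurable_fst hS)

theorem exists_iteratedLpNorm_pieceFn_le (hp : ∀ i, 1 < p i ∧ p i < ∞) (hN : IsMaxNorm N) :
    ∃ C : ℝ≥0, ∀ G : (Fin n → ℝ) → κ → ℝ≥0∞, Measurable (Function.uncurry G) →
      ∀ (j : ℤ) (m : Fin n → ℤ) (l : ℕ),
        iteratedLpNorm n p ((coordCube j m).indicator fun x =>
            N fun k => pieceFn j m (fun y => G y k) l x)
          ≤ C * ((2 : ℝ≥0∞) ^ (-(l * ∑ i, ((p i)⁻¹).toReal)) * iteratedLpNorm n p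
            ((tripleCube (j - l) (ancestor l m)).indicator fun x => N (G x))) := by
  obtain ⟨C, hC⟩ := exists_iteratedLpNorm_strongMax_le hp hN
  set σ := ∑ i, ((p i)⁻¹).toReal with hσ
  have hloc : ∀ G : (Fin n → ℝ) → κ → ℝ≥0∞, Measurable (Function.uncurry G) →
      ∀ (j : ℤ) (m : Fin n → ℤ), iteratedLpNorm n p (fun x =>
        N fun k => strongMax n ((tripleCube j m).indicator fun y => G y k) x)
          ≤ C * iteratedLpNorm n p ((tripleCube j m).indicator fun x => N (G x)) := by
    intro G hG j m
    have := hC _ (measurable_indicator_prod (measurableSet_tripleCube j m) hG)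
    simp_rw [hN.map_indicator] at this
    exact this
  refine ⟨6 ^ n * C, fun G hG j m l => ?_⟩
  by_cases hl : l = 0
  · subst hl
    have ha : ancestor 0 m = m := by ext i; simp [ancestor]
    simp only [pieceFn, if_true, Nat.cast_zero, zero_mul, neg_zero, ENNReal.rpow_zero, one_mul, ha,
      sub_zero]
    refine (iteratedLpNorm_mono hp fun x => Set.indicator_le_self (coordCube j m) _ x).trans
      ((hloc G hG j m).trans (mul_le_mul_left ?_ _))
    push_cast
    exact le_mul_of_one_le_left' (one_le_pow₀ (by norm_num))
  · simp only [pieceFn, if_neg hl]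
    set j' := j - (l : ℤ) with hj'
    set m' := ancestor l m with hm'
    set A := N fun k => tripleAvg j' m' fun y => G y k with hA
    have hcst : ∀ (j : ℤ) (m : Fin n → ℤ), iteratedLpNorm n p ((coordCube j m).indicator fun _ => A)
        = A * side j ^ σ := by
      intro j m
      rw [hσ, ← iteratedLpNorm_indicator_coordCube hp j m, ← iteratedLpNorm_const_mul_of_measurable
        hp A (measurable_const.indicator (measurableSet_coordCube j m))]
      congr 1; ext x
      by_cases hx : x ∈ coordCube j m <;> simp [hx]
    have h1 : A * side j' ^ σ ≤ 6 ^ n * (C * iteratedLpNorm n p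
        ((tripleCube j' m').indicator fun x => N (G x))) := by
      rw [← hcst j' m']
      refine le_trans ?_ (mul_le_mul_right (hloc G hG j' m') _)
      rw [← iteratedLpNorm_const_mul hp (by finiteness)]
      refine iteratedLpNorm_mono hp fun x => ?_
      by_cases hx : x ∈ coordCube j' m'
      · rw [Set.indicator_of_mem hx]
        have h2 := hN.const_mul (6 ^ n) fun k =>
          strongMax n ((tripleCube j' m').indicator fun y => G y k) x
        push_cast at h2
        rw [← h2]
        refine hN.mono _ _ fun k => tripleAvg_le_strongMax ?_ (coordCube_subset_tripleCube _ _ hx)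
        exact hG.comp (measurable_id.prodMk measurable_const)
      · rw [Set.indicator_of_notMem hx]; exact zero_le
    -- For l ≥ 1 the piece is constant on the cube, so its norm is exactly the constant times `side
    -- j ^ σ`. Comparing with the ancestor gains 2^{-lσ}, and on the ancestor the constant is
    -- controlled by the strong maximal function.
    have hs : side j ^ σ = (2 : ℝ≥0∞) ^ (-(l * σ)) * side j' ^ σ := by
      rw [side_eq_rpow, side_eq_rpow, ← ENNReal.rpow_mul, ← ENNReal.rpow_mul,
        ← ENNReal.rpow_add _ _ (by norm_num) (by norm_num), hj']
      congr 1; push_cast; ring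
    rw [hcst, hs]
    calc A * ((2 : ℝ≥0∞) ^ (-(l * σ)) * side j' ^ σ)
        = (2 : ℝ≥0∞) ^ (-(l * σ)) * (A * side j' ^ σ) := by ring
      _ ≤ (2 : ℝ≥0∞) ^ (-(l * σ)) * (6 ^ n * (C * iteratedLpNorm n p
          ((tripleCube j' m').indicator fun x => N (G x)))) := by gcongr
      _ = _ := by push_cast; ring

theorem exists_iteratedLpNorm_hlFn_le (hp : ∀ i, 1 < p i ∧ p i < ∞) (hN : IsMaxNorm N) :
    ∃ C : ℝ≥0, ∀ g : EuclideanSpace ℝ (Fin n) → κ → ℝ≥0∞, Measurable (Function.uncurry g) →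
      ∀ (j : ℤ) (m : Fin n → ℤ),
        iteratedLpNorm n p ((coordCube j m).indicator fun x =>
            N fun k => hlFn (fun y => g y k) (WithLp.toLp 2 x))
          ≤ C * ∑' l : ℕ, (2 : ℝ≥0∞) ^ (-(l * ∑ i, ((p i)⁻¹).toReal)) * iteratedLpNorm n p
            ((tripleCube (j - l) (ancestor l m)).indicator fun x => N (g (WithLp.toLp 2 x))) := by
  obtain ⟨C₀, hC₀⟩ := hlFn_le_tsum_pieceFn n
  obtain ⟨C₁, hC₁⟩ := exists_iteratedLpNorm_pieceFn_le hp hN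
  refine ⟨C₀ * C₁, fun g hg j m => ?_⟩
  set G : (Fin n → ℝ) → κ → ℝ≥0∞ := fun y => g (WithLp.toLp 2 y) with hGdef
  have htoLp : Measurable (WithLp.toLp 2 : (Fin n → ℝ) → EuclideanSpace ℝ (Fin n)) :=
    (PiLp.volume_preserving_toLp (Fin n)).measurable
  have hG : Measurable (Function.uncurry G) :=
    hg.comp ((htoLp.comp measurable_fst).prodMk measurable_snd)
  have hpm : ∀ l, Measurable (Function.uncurry fun (x : Fin n → ℝ) k =>
      pieceFn j m (fun y => G y k) l x) := by
    intro l
    unfold pieceFn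
    split_ifs
    · exact measurable_strongMax_swap
        (measurable_indicator_prod (measurableSet_tripleCube j m) hG)
    · have : Measurable fun k => tripleAvg (j - l) (ancestor l m) fun y => G y k :=
        (Measurable.lintegral_prod_left hG).const_mul _
      exact this.comp measurable_snd
  have hNm : ∀ l, Measurable ((coordCube j m).indicator fun x =>
      N fun k => pieceFn j m (fun y => G y k) l x) := fun l =>
    (hN.measurable _ (hpm l)).indicator (measurableSet_coordCube j m)
  -- Passing to the measurable pieces uses only monotonicity, so the measurability of `hlFn` is
  -- never needed.
  calc _ ≤ iteratedLpNorm n p (fun x => C₀ * ∑' l, (coordCube j m).indicator (fun x =>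
          N fun k => pieceFn j m (fun y => G y k) l x) x) := by
        refine iteratedLpNorm_mono hp fun x => ?_
        by_cases hx : x ∈ coordCube j m
        · simp only [Set.indicator_of_mem hx]
          refine (hN.mono _ _ fun k => hC₀ (fun y => g y k) ?_ j m x hx).trans ?_
          · exact hg.comp (measurable_id.prodMk measurable_const)
          · rw [hN.const_mul]
            gcongr
            refine hN.tsum_le _ fun l => ?_
            exact (hpm l).comp (measurable_const.prodMk measurable_id)
        · rw [Set.indicator_of_notMem hx]; exact zero_le
    _ = C₀ * iteratedLpNorm n p (fun x => ∑' l, (coordCube j m).indicator (fun x =>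
          N fun k => pieceFn j m (fun y => G y k) l x) x) :=
        iteratedLpNorm_const_mul hp ENNReal.coe_ne_top _
    _ ≤ C₀ * ∑' l, iteratedLpNorm n p ((coordCube j m).indicator fun x =>
          N fun k => pieceFn j m (fun y => G y k) l x) := by
        gcongr; exact iteratedLpNorm_tsum_le hp hNm
    _ ≤ C₀ * ∑' l : ℕ, C₁ * ((2 : ℝ≥0∞) ^ (-(l * ∑ i, ((p i)⁻¹).toReal)) * iteratedLpNorm n p
            ((tripleCube (j - l) (ancestor l m)).indicator fun x => N (G x))) := by
        gcongr with l; exact hC₁ G hG j m l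
    _ = _ := by
        rw [ENNReal.tsum_mul_left, ENNReal.coe_mul, mul_assoc]

end LocalEstimate

/-! ### Summation over all dyadic cubes. -/

section GlobalEstimate

variable {n : ℕ} {p : Fin n → ℝ≥0∞} {t r : ℝ≥0∞}

theorem toLp_preimage_dyadicCube (j : ℤ) (m : Fin n → ℤ) :
    (WithLp.toLp 2 : (Fin n → ℝ) → EuclideanSpace ℝ (Fin n)) ⁻¹' dyadicCube j m
      = coordCube j m := by
  ext x
  simp [dyadicCube, coordCube]

theorem measurableSet_dyadicCube (j : ℤ) (m : Fin n → ℤ) :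
    MeasurableSet (dyadicCube j m : Set (EuclideanSpace ℝ (Fin n))) := by
  have hc : ∀ i, Measurable fun x : EuclideanSpace ℝ (Fin n) => x i := fun i =>
    (EuclideanSpace.proj (𝕜 := ℝ) i).measurable
  rw [dyadicCube, Set.ofPred_forall]
  exact MeasurableSet.iInter fun i =>
    (measurableSet_le measurable_const (hc i)).inter (measurableSet_lt (hc i) measurable_const)

theorem volume_dyadicCube (j : ℤ) (m : Fin n → ℤ) :
    volume (dyadicCube j m : Set (EuclideanSpace ℝ (Fin n))) = side j ^ n := by
  rw [← (PiLp.volume_preserving_toLp (Fin n)).measure_preimage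
    (measurableSet_dyadicCube j m).nullMeasurableSet, toLp_preimage_dyadicCube, coordCube,
    volume_pi_pi]
  have : ∀ i, volume (Set.Ico ((2 : ℝ) ^ (-j) * (m i : ℝ)) ((2 : ℝ) ^ (-j) * ((m i : ℝ) + 1)))
      = side j := by
    intro i
    rw [Real.volume_Ico, side]; congr 1; ring
  simp_rw [this]
  simp

/-- The `Q`-th entry of the sequence whose `ℓ^r` norm is the mixed Bourgain–Morrey norm. -/
def bmEntry (p : Fin n → ℝ≥0∞) (t : ℝ≥0∞) (Φ : (Fin n → ℝ) → ℝ≥0∞) (Q : ℤ × (Fin n → ℤ)) :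
    ℝ≥0∞ :=
  side Q.1 ^ (n * (t⁻¹).toReal - ∑ i, ((p i)⁻¹).toReal) *
    iteratedLpNorm n p ((coordCube Q.1 Q.2).indicator Φ)

theorem mixedBMNorm_eq_ellNorm_bmEntry (hn : 1 ≤ n) (Φ : EuclideanSpace ℝ (Fin n) → ℝ≥0∞) :
    mixedBMNorm p t r Φ = ellNorm r (bmEntry p t fun x => Φ (WithLp.toLp 2 x)) := by
  unfold mixedBMNorm
  congr 1; ext Q
  rw [bmEntry, volume_dyadicCube, ← ENNReal.rpow_natCast, ← ENNReal.rpow_mul]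
  have hn0 : (n : ℝ) ≠ 0 := by positivity
  congr 1
  · congr 1; field_simp
  · unfold mixedLpNorm
    congr 1; ext x
    rw [← toLp_preimage_dyadicCube]
    by_cases hx : WithLp.toLp 2 x ∈ dyadicCube Q.1 Q.2
    · rw [Set.indicator_of_mem hx, Set.indicator_of_mem (Set.mem_preimage.2 hx)]; simp
    · rw [Set.indicator_of_notMem hx, Set.indicator_of_notMem (s := _ ⁻¹' _) hx]; simp

theorem mixedBMNorm_congr_ae (hn : 1 ≤ n) {Φ Ψ : EuclideanSpace ℝ (Fin n) → ℝ≥0∞}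
    (h : Φ =ᵐ[volume] Ψ) : mixedBMNorm p t r Φ = mixedBMNorm p t r Ψ := by
  rw [mixedBMNorm_eq_ellNorm_bmEntry hn, mixedBMNorm_eq_ellNorm_bmEntry hn]
  congr 1; ext Q
  have h' := (PiLp.volume_preserving_toLp (Fin n)).quasiMeasurePreserving.ae h
  rw [bmEntry, bmEntry]
  congr 1
  refine iteratedLpNorm_congr_ae ?_
  filter_upwards [h'] with x hx
  by_cases hxQ : x ∈ coordCube Q.1 Q.2 <;> simp [hxQ, hx]

theorem mixedBMNorm_mono (hn : 1 ≤ n) (hp : ∀ i, 1 < p i ∧ p i < ∞)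
    {Φ Ψ : EuclideanSpace ℝ (Fin n) → ℝ≥0∞} (h : ∀ x, Φ x ≤ Ψ x) :
    mixedBMNorm p t r Φ ≤ mixedBMNorm p t r Ψ := by
  rw [mixedBMNorm_eq_ellNorm_bmEntry hn, mixedBMNorm_eq_ellNorm_bmEntry hn]
  refine ellNorm_mono fun Q => ?_
  rw [bmEntry, bmEntry]
  gcongr
  exact iteratedLpNorm_mono hp fun x => Set.indicator_le_indicator (h _)

/-- The analogue of `bmEntry` for the threefold dilate of a cube. -/
def bmTripleEntry (p : Fin n → ℝ≥0∞) (t : ℝ≥0∞) (Φ : (Fin n → ℝ) → ℝ≥0∞)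
    (Q : ℤ × (Fin n → ℤ)) : ℝ≥0∞ :=
  side Q.1 ^ (n * (t⁻¹).toReal - ∑ i, ((p i)⁻¹).toReal) *
    iteratedLpNorm n p ((tripleCube Q.1 Q.2).indicator Φ)

/-- The dilate is covered by 3^n cubes of the same size, and each of the 3^n translations permutes
the dyadic cubes, so it preserves the ℓ^r norm. -/
theorem ellNorm_bmTripleEntry_le (hp : ∀ i, 1 < p i ∧ p i < ∞) (hr : 1 < r)
    {Φ : (Fin n → ℝ) → ℝ≥0∞} (hΦ : Measurable Φ) :
    ellNorm r (bmTripleEntry p t Φ) ≤ 3 ^ n * ellNorm r (bmEntry p t Φ) := by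
  let shift : (Fin n → Fin 3) → ℤ × (Fin n → ℤ) ≃ ℤ × (Fin n → ℤ) := fun e =>
    (Equiv.refl ℤ).prodCongr (Equiv.addRight fun i => ((e i : ℤ) - 1))
  have hshift : ∀ e Q, shift e Q = (Q.1, fun i => Q.2 i + ((e i : ℤ) - 1)) := fun e Q => rfl
  calc ellNorm r (bmTripleEntry p t Φ)
      ≤ ellNorm r (∑ e : Fin n → Fin 3, fun Q => bmEntry p t Φ (shift e Q)) := by
        refine ellNorm_mono fun Q => ?_
        rw [Finset.sum_apply]
        simp only [bmTripleEntry, bmEntry, hshift]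
        rw [← Finset.mul_sum]
        gcongr
        refine le_trans (iteratedLpNorm_mono hp fun x => ?_) (iteratedLpNorm_sum_le hp _ fun e =>
          hΦ.indicator (measurableSet_coordCube _ _))
        by_cases hx : x ∈ tripleCube Q.1 Q.2
        · obtain ⟨e, he⟩ := tripleCube_subset_iUnion Q.1 Q.2 hx
          rw [Set.indicator_of_mem hx, Finset.sum_apply]
          refine le_trans (le_of_eq ?_) (Finset.single_le_sum (fun _ _ => zero_le)
            (Finset.mem_univ e))
          rw [Set.indicator_of_mem he]
        · rw [Set.indicator_of_notMem hx]; exact zero_le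
    _ ≤ ∑ e : Fin n → Fin 3, ellNorm r (fun Q => bmEntry p t Φ (shift e Q)) :=
        ellNorm_sum_le hr _ _
    _ = 3 ^ n * ellNorm r (bmEntry p t Φ) := by
        rw [Finset.sum_congr rfl fun e _ => ellNorm_comp_equiv (shift e) (bmEntry p t Φ)]
        simp

variable {κ : Type} [MeasurableSpace κ] {N : (κ → ℝ≥0∞) → ℝ≥0∞}

/-- The Hardy–Littlewood maximal operator, acting on functions with values in a lattice with norm
`N`, is bounded for the mixed Bourgain–Morrey norm. -/
theorem exists_mixedBMNorm_hlFn_le (hn : 1 ≤ n) (hp : ∀ i, 1 < p i ∧ p i < ∞) (ht : 1 < t)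
    (htr : t < r) (hN : IsMaxNorm N) :
    ∃ C : ℝ≥0, ∀ g : EuclideanSpace ℝ (Fin n) → κ → ℝ≥0∞, Measurable (Function.uncurry g) →
      mixedBMNorm p t r (fun x => N fun k => hlFn (fun y => g y k) x)
        ≤ C * mixedBMNorm p t r (fun x => N (g x)) := by
  have hr : 1 < r := ht.trans htr
  obtain ⟨C, hC⟩ := exists_iteratedLpNorm_hlFn_le hp hN
  set τ := (t⁻¹).toReal with hτ
  set ρ := (r⁻¹).toReal with hρ
  have hτρ : ρ < τ := by
    rw [hτ, hρ]
    exact (ENNReal.toReal_lt_toReal (ENNReal.inv_ne_top.2 (by positivity))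
      (ENNReal.inv_ne_top.2 (by positivity))).2 (ENNReal.inv_lt_inv.2 htr)
  set σ := ∑ i, ((p i)⁻¹).toReal with hσ
  -- The ratio of the geometric series: 2^{-n/t} is the decay per generation and 2^{n/r} the
  -- multiplicity of ancestors. It is below 1 because t < r.
  set x₀ : ℝ≥0∞ := (2 : ℝ≥0∞) ^ (-(n * (τ - ρ))) with hx₀
  have hx₀1 : x₀ < 1 := by
    refine ENNReal.rpow_lt_one_of_one_lt_of_neg (by norm_num) ?_
    have : (0 : ℝ) < n := by positivity
    have : 0 < n * (τ - ρ) := mul_pos this (by linarith)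
    linarith
  set D : ℝ≥0∞ := C * ((1 - x₀)⁻¹ * 3 ^ n) with hD
  have hDt : D ≠ ∞ := by
    refine ENNReal.mul_ne_top ENNReal.coe_ne_top (ENNReal.mul_ne_top ?_ (by finiteness))
    exact ENNReal.inv_ne_top.2 (tsub_pos_of_lt hx₀1).ne'
  refine ⟨D.toNNReal, fun g hg => ?_⟩
  rw [ENNReal.coe_toNNReal hDt, mixedBMNorm_eq_ellNorm_bmEntry hn,
    mixedBMNorm_eq_ellNorm_bmEntry hn]
  set Φ : (Fin n → ℝ) → ℝ≥0∞ := fun x => N (g (WithLp.toLp 2 x)) with hΦ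
  have hΦm : Measurable Φ :=
    (hN.measurable g hg).comp (PiLp.volume_preserving_toLp (Fin n)).measurable
  calc _ ≤ ellNorm r (fun Q : ℤ × (Fin n → ℤ) => C * ∑' l : ℕ, (2 : ℝ≥0∞) ^ (-(l * n * τ)) *
        bmTripleEntry p t Φ (Q.1 - l, ancestor l Q.2)) := by
        refine ellNorm_mono fun Q => ?_
        rw [bmEntry]
        refine (mul_le_mul_right (hC g hg Q.1 Q.2) _).trans (le_of_eq ?_)
        rw [mul_left_comm, ← ENNReal.tsum_mul_left]
        congr 2; ext l
        rw [bmTripleEntry, ← mul_assoc, ← mul_assoc]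
        congr 1
        -- The exponents add up: the weight of the cube is 2^{-l(nτ-σ)} times that of its ancestor,
        -- and the local estimate contributes 2^{-lσ}.
        simp only [side_eq_rpow]
        rw [← ENNReal.rpow_mul, ← ENNReal.rpow_mul,
          ← ENNReal.rpow_add _ _ (by norm_num) (by norm_num),
          ← ENNReal.rpow_add _ _ (by norm_num) (by norm_num)]
        congr 1; push_cast; ring
    _ ≤ C * ∑' l : ℕ, (2 : ℝ≥0∞) ^ (-(l * n * τ)) *
          ellNorm r (fun Q : ℤ × (Fin n → ℤ) =>
            bmTripleEntry p t Φ (Q.1 - l, ancestor l Q.2)) := by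
        rw [ellNorm_const_mul hr]
        gcongr
        refine (ellNorm_tsum_le hr fun (l : ℕ) (Q : ℤ × (Fin n → ℤ)) =>
          (2 : ℝ≥0∞) ^ (-(l * n * τ)) * bmTripleEntry p t Φ (Q.1 - l, ancestor l Q.2)).trans
          (le_of_eq ?_)
        congr 1; ext l
        exact ellNorm_const_mul hr _ _
    _ ≤ C * ∑' l : ℕ, x₀ ^ l * (3 ^ n * ellNorm r (bmEntry p t Φ)) := by
        refine mul_le_mul_right (ENNReal.tsum_le_tsum fun l => ?_) _
        refine (mul_le_mul_right ((ellNorm_comp_ancestor_le hr l (bmTripleEntry p t Φ)).trans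
          (mul_le_mul_right (ellNorm_bmTripleEntry_le hp hr hΦm) _)) _).trans (le_of_eq ?_)
        rw [← mul_assoc, ← ENNReal.rpow_add _ _ (by norm_num) (by norm_num), hx₀,
          ← ENNReal.rpow_natCast _ l, ← ENNReal.rpow_mul]
        congr 2; ring
    _ = D * ellNorm r (bmEntry p t Φ) := by
        rw [ENNReal.tsum_mul_right, ENNReal.tsum_geometric, hD]; ring

end GlobalEstimate

/-! ### Sequence norms. -/

section VectorValued

variable {n : ℕ} {p : Fin n → ℝ≥0∞} {t r : ℝ≥0∞}

theorem hlFn_mono {g g' : EuclideanSpace ℝ (Fin n) → ℝ≥0∞} (h : ∀ x, g x ≤ g' x)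
    (x : EuclideanSpace ℝ (Fin n)) : hlFn g x ≤ hlFn g' x := by
  unfold hlFn
  gcongr with c R hx
  exact h _

theorem hlFn_congr_ae {g g' : EuclideanSpace ℝ (Fin n) → ℝ≥0∞} (h : g =ᵐ[volume] g') :
    hlFn g = hlFn g' := by
  ext x
  unfold hlFn
  refine iSup_congr fun c => iSup_congr fun R => iSup_congr fun _ => ?_
  rw [lintegral_congr_ae (ae_restrict_of_ae h)]

theorem isMaxNorm_ellNorm {u : ℝ≥0∞} (hu : 1 < u) (hut : u < ∞) :
    IsMaxNorm fun f : ℕ × Unit → ℝ≥0∞ => ellNorm u fun k => f (k, ()) := by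
  simp_rw [ellNorm_eq_powNorm hut.ne]
  exact isMaxNorm_unit.powNorm Measure.count (one_lt_toReal hu hut)

theorem isMaxNorm_ellNorm_ellNorm {u₁ u₂ : ℝ≥0∞} (hu₁ : 1 < u₁) (hut₁ : u₁ < ∞) (hu₂ : 1 < u₂)
    (hut₂ : u₂ < ∞) :
    IsMaxNorm fun f : ℕ × ℕ × Unit → ℝ≥0∞ =>
      ellNorm u₂ fun k₂ => ellNorm u₁ fun k₁ => f (k₂, k₁, ()) := by
  simp_rw [ellNorm_eq_powNorm hut₂.ne]
  exact (isMaxNorm_ellNorm hu₁ hut₁).powNorm Measure.count (one_lt_toReal hu₂ hut₂)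

/-- The supremum of the maximal functions is at most the maximal function of the supremum, so the
scalar inequality suffices. -/
theorem exists_mixedBMNorm_iSup_hlFn_le (hn : 1 ≤ n) (hp : ∀ i, 1 < p i ∧ p i < ∞) (ht : 1 < t)
    (htr : t < r) :
    ∃ C : ℝ≥0, ∀ g : ℕ → EuclideanSpace ℝ (Fin n) → ℝ≥0∞, (∀ k, Measurable (g k)) →
      mixedBMNorm p t r (fun x => ⨆ k, hlFn (g k) x)
        ≤ C * mixedBMNorm p t r (fun x => ⨆ k, g k x) := by
  obtain ⟨C, hC⟩ := exists_mixedBMNorm_hlFn_le hn hp ht htr isMaxNorm_unit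
  refine ⟨C, fun g hg => ?_⟩
  refine (mixedBMNorm_mono hn hp fun x => ?_).trans
    (hC (fun y _ => ⨆ k, g k y) ((Measurable.iSup hg).comp measurable_fst))
  exact iSup_le fun k => hlFn_mono (fun y => le_iSup (fun k => g k y) k) x

end VectorValued

end

/-! ### The theorem. -/

theorem theorem6p20 (n : ℕ) (hn : 1 ≤ n) (p : Fin n → ℝ≥0∞) (t r : ℝ≥0∞)
    (hp : ∀ i, 1 < p i ∧ p i < ∞)
    (htr : (1 < (n : ℝ≥0∞) / ∑ i, (p i)⁻¹ ∧ (n : ℝ≥0∞) / ∑ i, (p i)⁻¹ < t ∧ t < r ∧ r < ∞) ∨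
      (1 < (n : ℝ≥0∞) / ∑ i, (p i)⁻¹ ∧ (n : ℝ≥0∞) / ∑ i, (p i)⁻¹ ≤ t ∧ t < r ∧ r = ∞)) :
    (∀ u : ℝ≥0∞, 1 < u → ∃ C : ℝ≥0,
      ∀ f : ℕ → EuclideanSpace ℝ (Fin n) → ℂ, MemMixedBMSeq p t r u f →
        mixedBMSeqNorm p t r u (fun k => hlMaximal (f k)) ≤ C * mixedBMSeqNorm p t r u f) ∧
    (∀ u₁ u₂ : ℝ≥0∞, 1 < u₁ → u₁ < ∞ → 1 < u₂ → u₂ < ∞ → ∃ C : ℝ≥0,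
      ∀ f : ℕ → ℕ → EuclideanSpace ℝ (Fin n) → ℂ, (∀ k₁ k₂, AEMeasurable (f k₁ k₂) volume) →
        mixedBMNorm p t r
            (fun x => ellNorm u₂ (fun k₂ => ellNorm u₁ (fun k₁ => hlMaximal (f k₁ k₂) x))) ≤
          C * mixedBMNorm p t r
            (fun x => ellNorm u₂ (fun k₂ => ellNorm u₁ (fun k₁ => ‖f k₁ k₂ x‖ₑ)))) := by
  have ht : 1 < t := by
    rcases htr with h | h
    · exact h.1.trans h.2.1
    · exact h.1.trans_le h.2.1
  have htr' : t < r := by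
    rcases htr with h | h
    · exact h.2.2.1
    · exact h.2.2.1
  refine ⟨fun u hu => ?_, fun u₁ u₂ hu₁ hut₁ hu₂ hut₂ => ?_⟩
  · suffices h : ∃ C : ℝ≥0, ∀ g : ℕ → EuclideanSpace ℝ (Fin n) → ℝ≥0∞, (∀ k, Measurable (g k)) →
        mixedBMNorm p t r (fun x => ellNorm u fun k => hlFn (g k) x)
          ≤ C * mixedBMNorm p t r (fun x => ellNorm u fun k => g k x) by
      obtain ⟨C, hC⟩ := h
      refine ⟨C, fun f hf => ?_⟩
      -- Measurable representatives change neither side: averages over balls ignore null sets, and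
      -- so does the mixed norm.
      have hae : ∀ k, (fun x => ‖f k x‖ₑ) =ᵐ[volume] fun x => ‖(hf.1 k).mk (f k) x‖ₑ := fun k =>
        (hf.1 k).ae_eq_mk.mono fun x hx => by simp only [hx]
      have h1 := hC (fun k x => ‖(hf.1 k).mk (f k) x‖ₑ) fun k => (hf.1 k).measurable_mk.enorm
      have h2 : mixedBMNorm p t r (fun x => ellNorm u fun k => ‖f k x‖ₑ)
          = mixedBMNorm p t r (fun x => ellNorm u fun k => ‖(hf.1 k).mk (f k) x‖ₑ) := by
        refine mixedBMNorm_congr_ae hn ?_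
        filter_upwards [ae_all_iff.2 hae] with x hx
        simp only [hx]
      simp_rw [← hlFn_congr_ae (hae _)] at h1
      rw [← h2] at h1
      exact h1
    by_cases hut : u = ∞
    · subst hut
      simpa [ellNorm] using exists_mixedBMNorm_iSup_hlFn_le hn hp ht htr'
    · obtain ⟨C, hC⟩ := exists_mixedBMNorm_hlFn_le hn hp ht htr'
        (isMaxNorm_ellNorm hu (lt_top_iff_ne_top.2 hut))
      refine ⟨C, fun g hg => hC (fun x k => g k.1 x) ?_⟩
      -- The index set is countable, so measurability for each index gives joint measurability.
      exact measurable_from_prod_countable_left fun k => hg k.1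
  · obtain ⟨C, hC⟩ := exists_mixedBMNorm_hlFn_le hn hp ht htr'
      (isMaxNorm_ellNorm_ellNorm hu₁ hut₁ hu₂ hut₂)
    refine ⟨C, fun f hf => ?_⟩
    have hae : ∀ k₁ k₂, (fun x => ‖f k₁ k₂ x‖ₑ) =ᵐ[volume]
        fun x => ‖(hf k₁ k₂).mk (f k₁ k₂) x‖ₑ := fun k₁ k₂ =>
      (hf k₁ k₂).ae_eq_mk.mono fun x hx => by simp only [hx]
    have h1 := hC (fun x k => ‖(hf k.2.1 k.1).mk (f k.2.1 k.1) x‖ₑ)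
      (measurable_from_prod_countable_left fun k => (hf k.2.1 k.1).measurable_mk.enorm)
    have h2 : mixedBMNorm p t r
          (fun x => ellNorm u₂ fun k₂ => ellNorm u₁ fun k₁ => ‖f k₁ k₂ x‖ₑ)
        = mixedBMNorm p t r (fun x => ellNorm u₂ fun k₂ => ellNorm u₁ fun k₁ =>
          ‖(hf k₁ k₂).mk (f k₁ k₂) x‖ₑ) := by
      refine mixedBMNorm_congr_ae hn ?_
      filter_upwards [ae_all_iff.2 fun k₁ => ae_all_iff.2 (hae k₁)] with x hx
      simp only [hx]
    simp_rw [← hlFn_congr_ae (hae _ _)] at h1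
    rw [← h2] at h1
    exact h1
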